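/- Let $q\in\mathbb{C}$ with $0<|q|<1$, and write $(x;q)_n=\prod_{k=0}^{n-1}(1-xq^k)$ and $(x;q)_\infty=\prod_{k\ge 0}(1-xq^k)$. Let $\varepsilon_b,\varepsilon_c,\varepsilon_d,\varepsilon_e,\lambda_b,\lambda_c,\lambda_d,\lambda_e$ be nonnegative integers with $\Lambda:=\lambda_b+\lambda_c+\lambda_d+\lambda_e\geq 1$ such that, with $\langle n\rangle_x:=\lfloor(\varepsilon_x+n\lambda_x)/\Lambda\rfloor$ for $x\in\{b,c,d,e\}$, $$n=\langle n\rangle_b+\langle n\rangle_c+\langle n\rangle_d+\langle n\rangle_e\qquad\text{for all integers } n\ge 0 .$$ For nonzero complex numbers $a,b,c,d$ define $$\begin{aligned}\phi(x;n)={}&(bx;q)_{\langle n\rangle_b}(cx;q)_{\langle n\rangle_c}(dx;q)_{\langle n\rangle_d}\Big(\frac{qa^2x}{bcd};q\Big)_{\langle n\rangle_e}\\&\times\Big(\frac{b}{ax};q\Big)_{\langle n\rangle_b}\Big(\frac{c}{ax};q\Big)_{\langle n\rangle_c}\Big(\frac{d}{ax};q\Big)_{\langle n\rangle_d}\Big(\frac{qa}{bcdx};q\Big)_{\langle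 n\rangle_e},\end{aligned}$$ $$\Theta(m)=q^{\binom m2-\binom{\langle m\rangle_b}2-\binom{\langle m\rangle_c}2-\binom{\langle m\rangle_d}2-\binom{\langle m\rangle_e}2}\Big(\frac ab\Big)^{\langle m\rangle_b}\Big(\frac ac\Big)^{\langle m\rangle_c}\Big(\frac ad\Big)^{\langle m\rangle_d}\Big(\frac{bcd}{qa}\Big)^{\langle m\rangle_e},$$ $$\begin{aligned}H(n)={}&\frac{(b;q)_{\langle n\rangle_b}(c;q)_{\langle n\rangle_c}(d;q)_{\langle n\rangle_d}(qa^2/bcd;q)_{\langle n\rangle_e}}{(q;q)_n\,(bcd/a;q)_{\langle n\rangle_b+\langle n\rangle_c+\langle n\rangle_d}}\cdot\frac{(bc/a;q)_{\langle n\rangle_b+\langle n\rangle_c}(qa/bc;q)_{\langle n\rangle_d+\langle n\rangle_e}}{(qa/b;q)_{\langle n\rangle_c+\langle n\rangle_d+\langle n\rangle_e}}\\&\times\frac{(bd/a;q)_{\langle n\rangle_b+\langle n\rangle_d}(qa/bd;q)_{\langle n\rangle_c+\langle n\rangle_e}}{(qa/c;q)_{\langle n\rangle_b+\langle n\rangle_d+\langle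 n\rangle_e}}\cdot\frac{(cd/a;q)_{\langle n\rangle_c+\langle n\rangle_d}(qa/cd;q)_{\langle n\rangle_b+\langle n\rangle_e}}{(qa/d;q)_{\langle n\rangle_b+\langle n\rangle_c+\langle n\rangle_e}}.\end{aligned}$$ Assume that the denominators occurring below do not vanish: none of $qa/b,\ qa/c,\ qa/d,\ bcd/a$ is of the form $q^{-n}$ with an integer $n\ge0$, $\phi(q^k;k)\ne0$ for all $k\ge0$, and $H(n\Lambda)\neq0$ for all $n\ge1$. In the degenerate case in which a single one of $\lambda_b,\lambda_c,\lambda_d,\lambda_e$ is nonzero, assume also that, respectively, $|a/b|<1$, $|a/c|<1$, $|a/d|<1$ or $|bcd/(qa)|<1$ (in all other cases there is no such condition). Then for every integer $\delta$ with $0\le\delta<\Lambda$ the outer series below converges absolutely and $$\begin{aligned}&\frac{(b;q)_\infty(c;q)_\infty(d;q)_\infty(qa^2/bcd;q)_\infty}{(qa/b;q)_\infty(qa/c;q)_\infty(qa/d;q)_\infty(bcd/a;q)_\infty}=\sum_{k=0}^{\delta-1}\Theta(k+1)\,\frac{\phi(q^k;k+1)}{-\phi(q^k;k)}\,H(k)\\&\qquad+\sum_{n=1}^{\infty}H(n\Lambda)\,\Theta(n\Lambda)\sum_{j=\delta-\Lambda}^{\delta-1}\frac{\Theta(1+j+n\Lambda)}{\Theta(n\Lambda)}\cdot\frac{\phi(q^{j+n\Lambda};1+j+n\Lambda)}{-\phi(q^{j+n\Lambda};j+n\Lambda)}\cdot\frac{H(j+n\Lambda)}{H(n\Lambda)}.\end{aligned}$$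 -/

import Mathlib

noncomputable section

namespace JacksonDual

/-- The finite `q`-shifted factorial `(x;q)_n = (1-x)(1-qx)⋯(1-q^{n-1}x)`. -/
def qPoch (x q : ℂ) (n : ℕ) : ℂ := ∏ k ∈ Finset.range n, (1 - x * q ^ k)

/-- The infinite `q`-shifted factorial `(x;q)_∞`, used for `‖q‖ < 1`. -/
def qPochInf (x q : ℂ) : ℂ := ∏' k : ℕ, (1 - x * q ^ k)

/-- For `‖q‖ < 1` the product that defines `(x;q)_∞` converges. -/
theorem multipliable_qPochInf (x q : ℂ) (hq : ‖q‖ < 1) :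
    Multipliable (fun k : ℕ => 1 - x * q ^ k) := by
  have h : Summable (fun k : ℕ => ‖-(x * q ^ k)‖) := by
    simpa [norm_mul, norm_pow] using
      (summable_geometric_of_lt_one (norm_nonneg q) hq).mul_left ‖x‖
  simpa [sub_eq_add_neg] using multipliable_one_add_of_summable h

/-- The eight nonnegative integers `ε_b, ε_c, ε_d, ε_e, λ_b, λ_c, λ_d, λ_e`. -/
structure Pattern where
  epsb : ℕ
  epsc : ℕ
  epsd : ℕ
  epse : ℕ
  lamb : ℕ
  lamc : ℕ
  lamd : ℕ
  lame : ℕ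

namespace Pattern

variable (P : Pattern)

/-- `Λ = λ_b + λ_c + λ_d + λ_e`. -/
def Lam : ℕ := P.lamb + P.lamc + P.lamd + P.lame

/-- `⟨n⟩_b = ⌊(ε_b + n λ_b) / Λ⌋`. -/
def pb (n : ℕ) : ℕ := (P.epsb + n * P.lamb) / P.Lam

/-- `⟨n⟩_c = ⌊(ε_c + n λ_c) / Λ⌋`. -/
def pc (n : ℕ) : ℕ := (P.epsc + n * P.lamc) / P.Lam

/-- `⟨n⟩_d = ⌊(ε_d + n λ_d) / Λ⌋`. -/
def pd (n : ℕ) : ℕ := (P.epsd + n * P.lamd) / P.Lam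

/-- `⟨n⟩_e = ⌊(ε_e + n λ_e) / Λ⌋`. -/
def pe (n : ℕ) : ℕ := (P.epse + n * P.lame) / P.Lam

/-- The partition property `n = ⟨n⟩_b + ⟨n⟩_c + ⟨n⟩_d + ⟨n⟩_e` for all `n ≥ 0`. It forces
`Λ > 0`, since all four quotients are `0` in Lean when `Λ = 0`. -/
def IsPartition : Prop := ∀ n : ℕ, n = P.pb n + P.pc n + P.pd n + P.pe n

end Pattern

/-- The polynomials `φ(x;n)` (in `x` and `1/x`). -/
def phi (P : Pattern) (a b c d q x : ℂ) (n : ℕ) : ℂ :=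
  qPoch (b * x) q (P.pb n) * qPoch (c * x) q (P.pc n) * qPoch (d * x) q (P.pd n) *
    qPoch (q * a ^ 2 * x / (b * c * d)) q (P.pe n) *
  (qPoch (b / (a * x)) q (P.pb n) * qPoch (c / (a * x)) q (P.pc n) *
    qPoch (d / (a * x)) q (P.pd n) * qPoch (q * a / (b * c * d * x)) q (P.pe n))

/-- The quotient `H(n)` of shifted factorials. -/
def H (P : Pattern) (a b c d q : ℂ) (n : ℕ) : ℂ :=
  (qPoch b q (P.pb n) * qPoch c q (P.pc n) * qPoch d q (P.pd n) *
      qPoch (q * a ^ 2 / (b * c * d)) q (P.pe n)) /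
    (qPoch q q n * qPoch (b * c * d / a) q (P.pb n + P.pc n + P.pd n)) *
  ((qPoch (b * c / a) q (P.pb n + P.pc n) * qPoch (q * a / (b * c)) q (P.pd n + P.pe n)) /
    qPoch (q * a / b) q (P.pc n + P.pd n + P.pe n)) *
  ((qPoch (b * d / a) q (P.pb n + P.pd n) * qPoch (q * a / (b * d)) q (P.pc n + P.pe n)) /
    qPoch (q * a / c) q (P.pb n + P.pd n + P.pe n)) *
  ((qPoch (c * d / a) q (P.pc n + P.pd n) * qPoch (q * a / (c * d)) q (P.pb n + P.pe n)) /
    qPoch (q * a / d) q (P.pb n + P.pc n + P.pe n))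

/-- The monomial `Θ(m)`. -/
def Theta (P : Pattern) (a b c d q : ℂ) (m : ℕ) : ℂ :=
  q ^ ((m.choose 2 : ℤ) - ((P.pb m).choose 2 : ℤ) - ((P.pc m).choose 2 : ℤ)
      - ((P.pd m).choose 2 : ℤ) - ((P.pe m).choose 2 : ℤ)) *
    (a / b) ^ P.pb m * (a / c) ^ P.pc m * (a / d) ^ P.pd m *
    (b * c * d / (q * a)) ^ P.pe m

/-- The infinite product `(b, c, d, qa²/bcd; q)_∞ / (qa/b, qa/c, qa/d, bcd/a; q)_∞`. -/
def productSide (a b c d q : ℂ) : ℂ :=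
  (qPochInf b q * qPochInf c q * qPochInf d q * qPochInf (q * a ^ 2 / (b * c * d)) q) /
    (qPochInf (q * a / b) q * qPochInf (q * a / c) q * qPochInf (q * a / d) q *
      qPochInf (b * c * d / a) q)

/-- The `n`-th term, `n ≥ 1`, of the outer series:
`H(nΛ) Θ(nΛ) ∑_{j=δ-Λ}^{δ-1} Θ(1+j+nΛ)/Θ(nΛ) · φ(q^{j+nΛ};1+j+nΛ)/(-φ(q^{j+nΛ};j+nΛ))
· H(j+nΛ)/H(nΛ)`. The inner index `j` is an integer, and `j + nΛ ≥ δ ≥ 0` when `n ≥ 1`, so that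
`Int.toNat` only changes the type of `j + nΛ`. -/
def blockTerm (P : Pattern) (a b c d q : ℂ) (δ n : ℕ) : ℂ :=
  H P a b c d q (n * P.Lam) * Theta P a b c d q (n * P.Lam) *
    ∑ j ∈ Finset.Ico ((δ : ℤ) - (P.Lam : ℤ)) (δ : ℤ),
      let m : ℕ := (j + (n : ℤ) * (P.Lam : ℤ)).toNat
      Theta P a b c d q (1 + m) / Theta P a b c d q (n * P.Lam) *
        (phi P a b c d q (q ^ m) (1 + m) / (-phi P a b c d q (q ^ m) m)) *
        (H P a b c d q m / H P a b c d q (n * P.Lam))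

end JacksonDual

end

noncomputable section

namespace JacksonDual

/-! ### The Wilf–Zeilberger certificate as a rational identity -/

/-! With `e = qa²/(bcd)`, i.e. `bcde = qa²`, everything becomes symmetric in `b, c, d, e`, and the
four floors trace a path in `ℕ⁴` that starts at the origin and raises one coordinate by one at each
step. If the `m`-th step raises the coordinate of the parameter `x` from `s` to `s + 1`, then
`Θ(m+1) φ(q^m;m+1) / (-φ(q^m;m))` equals `Θ(m) (1 - x q^(s+m)) (1 - a q^m / (x q^s))`. So the claim
is that `weight` times `stepProd`, summed along the path, gives the infinite product.

This is a Wilf–Zeilberger argument in a truncation parameter `N`. The product of the `(x;q)_N /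
(qa/x;q)_N` equals a finite sum along the path plus one end term (`Admissible.sum_truncTerm`). In
the induction on `N`, each summand contributes the difference of the values of one function on `ℕ⁴`,
`cert`, at the two ends of a step, so the sum telescopes along every path. As `cert` is symmetric in
the four parameters, only steps in the direction of `b` need checking, and there the claim reduces
to `certificate_identity`.

For `N → ∞`, dominated convergence applies (`Admissible.summable_and_tsum_eq`): the summands are
`O(Θ(m))` uniformly in `N`, and the ratios of `Θ` are eventually at most some `r < 1`. Splitting off
`δ` terms and grouping the rest in blocks of length `Λ` yields the stated form. -/

theorem certificate_identity {q a B C D E Q X α₁ α₂ β : ℂ}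
    (ha : a ≠ 0) (hB : B ≠ 0) (hC : C ≠ 0) (hD : D ≠ 0) (hE : E ≠ 0) (hQ : Q ≠ 0)
    (hrel : B * C * D * E = q * a ^ 2 * Q)
    (h : (∃ γ, α₁ = γ * (1 - a * X) ∧ α₂ = γ * (1 - a * Q * X) ∧ β = γ * (1 - Q)) ∨
      (Q = 1 ∧ α₁ = 1 ∧ α₂ = 1 ∧ β = 0)) :
    (1 - q * X) * α₂ * ((1 - a * q * X / C) * (1 - a * q * X / D) * (1 - a * q * X / E)) *
        (1 - B * Q) * (1 - a * X / B) -
      (1 - q * X / Q) * α₁ * (1 - B * q * X) * ((1 - C * X) * (1 - D * X) * (1 - E * X)) *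
        (1 - B * Q) =
    -(a * X / B * (1 - B) * ((1 - B * C / a) * (1 - B * D / a) * (1 - B * E / a)) *
        (1 - q * X / Q) * (1 - a * q * X ^ 2) * α₂) +
      q * X / Q * β * (1 - a * q * X ^ 2) *
        ((1 - a * Q / C) * (1 - a * Q / D) * (1 - a * Q / E)) * (1 - B * q * X) *
        (1 - a * X / B) := by
  -- Eliminating `q` leaves independent variables, so the claim becomes an identity of rational
  -- functions. It is used with `B = b q^i`, …, `E = e q^l`, `Q = q^(i+j+k+l)`, `X = q^N`.
  have hq : q = B * C * D * E / (a ^ 2 * Q) := by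
    field_simp
    linear_combination -hrel
  rcases h with ⟨γ, rfl, rfl, rfl⟩ | ⟨rfl, rfl, rfl, rfl⟩
  · subst hq
    field_simp
    ring
  · subst hq
    field_simp
    ring

end JacksonDual

namespace JacksonDual

/-! ### Elementary properties of shifted factorials -/

theorem qPoch_zero (x q : ℂ) : qPoch x q 0 = 1 := by simp [qPoch]

theorem qPoch_succ (x q : ℂ) (n : ℕ) :
    qPoch x q (n + 1) = qPoch x q n * (1 - x * q ^ n) := by
  simp [qPoch, Finset.prod_range_succ]

theorem qPoch_succ' (x q : ℂ) (n : ℕ) :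
    qPoch x q (n + 1) = (1 - x) * qPoch (x * q) q n := by
  simp only [qPoch, Finset.prod_range_succ', pow_zero, mul_one]
  rw [mul_comm]
  congr 1
  exact Finset.prod_congr rfl fun k _ => by ring

theorem qPoch_ne_zero {x q : ℂ} (h : ∀ n : ℕ, x * q ^ n ≠ 1) (n : ℕ) : qPoch x q n ≠ 0 :=
  Finset.prod_ne_zero_iff.2 fun k _ => sub_ne_zero.2 (h k).symm

/-- The alternative `i = 0` serves parameters whose coordinate never moves; for these `x q^n = 1` is
not excluded. -/
theorem qPoch_shift_ne_zero {x q : ℂ} {i : ℕ} (h : i = 0 ∨ ∀ n : ℕ, x * q ^ n ≠ 1) (N : ℕ) :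
    qPoch (x * q ^ N) q i ≠ 0 := by
  rcases h with rfl | h
  · simp [qPoch_zero]
  · exact qPoch_ne_zero (fun n => by rw [mul_assoc, ← pow_add]; exact h _) i

/-! ### Weights on the lattice `ℕ⁴` -/

/-- The symmetric form of the quotient `H`, on the lattice `ℕ⁴`. -/
def latticeH (q a b c d e : ℂ) (i j k l : ℕ) : ℂ :=
  qPoch b q i * qPoch c q j * qPoch d q k * qPoch e q l *
    (qPoch (b * c / a) q (i + j) * qPoch (b * d / a) q (i + k) * qPoch (b * e / a) q (i + l) *
      qPoch (c * d / a) q (j + k) * qPoch (c * e / a) q (j + l) * qPoch (d * e / a) q (k + l)) /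
  (qPoch q q (i + j + k + l) *
    (qPoch (q * a / b) q (j + k + l) * qPoch (q * a / c) q (i + k + l) *
      qPoch (q * a / d) q (i + j + l) * qPoch (q * a / e) q (i + j + k)))

/-- The symmetric form of the monomial `Θ`, on the lattice `ℕ⁴`. -/
def latticeTheta (q a b c d e : ℂ) (i j k l : ℕ) : ℂ :=
  q ^ (((i + j + k + l).choose 2 : ℤ) - (i.choose 2 : ℤ) - (j.choose 2 : ℤ) - (k.choose 2 : ℤ)
      - (l.choose 2 : ℤ)) *
    (a / b) ^ i * (a / c) ^ j * (a / d) ^ k * (a / e) ^ l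

/-- The product of `latticeTheta` and `latticeH`. -/
def weight (q a b c d e : ℂ) (i j k l : ℕ) : ℂ :=
  latticeTheta q a b c d e i j k l * latticeH q a b c d e i j k l

theorem latticeTheta_swap_bc (q a b c d e : ℂ) (i j k l : ℕ) :
    latticeTheta q a c b d e j i k l = latticeTheta q a b c d e i j k l := by
  simp only [latticeTheta, show j + i + k + l = i + j + k + l by ring,
    sub_right_comm _ (j.choose 2 : ℤ) (i.choose 2 : ℤ)]
  ring

theorem latticeTheta_swap_bd (q a b c d e : ℂ) (i j k l : ℕ) :
    latticeTheta q a d c b e k j i l = latticeTheta q a b c d e i j k l := by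
  simp only [latticeTheta, show k + j + i + l = i + j + k + l by ring,
    show ∀ z : ℤ, z - (k.choose 2 : ℤ) - (j.choose 2 : ℤ) - (i.choose 2 : ℤ) =
      z - (i.choose 2 : ℤ) - (j.choose 2 : ℤ) - (k.choose 2 : ℤ) from fun z => by ring]
  ring

theorem latticeTheta_swap_be (q a b c d e : ℂ) (i j k l : ℕ) :
    latticeTheta q a e c d b l j k i = latticeTheta q a b c d e i j k l := by
  simp only [latticeTheta, show l + j + k + i = i + j + k + l by ring,
    show ∀ z : ℤ, z - (l.choose 2 : ℤ) - (j.choose 2 : ℤ) - (k.choose 2 : ℤ) - (i.choose 2 : ℤ) =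
      z - (i.choose 2 : ℤ) - (j.choose 2 : ℤ) - (k.choose 2 : ℤ) - (l.choose 2 : ℤ)
      from fun z => by ring]
  ring

theorem latticeH_swap_bc (q a b c d e : ℂ) (i j k l : ℕ) :
    latticeH q a c b d e j i k l = latticeH q a b c d e i j k l := by
  simp only [latticeH, mul_comm c b, add_comm j i]
  ring

theorem latticeH_swap_bd (q a b c d e : ℂ) (i j k l : ℕ) :
    latticeH q a d c b e k j i l = latticeH q a b c d e i j k l := by
  simp only [latticeH, mul_comm d c, mul_comm d b, mul_comm c b, add_comm k j, add_comm k i,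
    add_comm j i, show j + k + i = i + j + k by ring]
  ring_nf

theorem latticeH_swap_be (q a b c d e : ℂ) (i j k l : ℕ) :
    latticeH q a e c d b l j k i = latticeH q a b c d e i j k l := by
  simp only [latticeH, mul_comm e c, mul_comm e b, mul_comm e d, mul_comm c b, mul_comm d b,
    add_comm l j, add_comm l k, add_comm l i, add_comm j i, add_comm k i,
    show j + l + k = j + k + l by ring,
    show j + k + i = i + j + k by ring, show k + l + i = i + k + l by ring,
    show j + l + i = i + j + l by ring]
  ring_nf

theorem latticeTheta_succ {q a b : ℂ} (c d e : ℂ) (hq : q ≠ 0) (i j k l : ℕ) :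
    latticeTheta q a b c d e (i + 1) j k l =
      latticeTheta q a b c d e i j k l * (a * q ^ (i + j + k + l) / (b * q ^ i)) := by
  have h1 : ((i + 1 + j + k + l).choose 2 : ℤ) = ((i + j + k + l).choose 2 : ℤ) + (i + j + k + l : ℕ) := by
    rw [show i + 1 + j + k + l = (i + j + k + l) + 1 by ring, Nat.choose_succ_succ' _ 1,
      Nat.choose_one_right]
    push_cast; ring
  have h2 : ((i + 1).choose 2 : ℤ) = (i.choose 2 : ℤ) + (i : ℕ) := by
    rw [Nat.choose_succ_succ' _ 1, Nat.choose_one_right]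
    push_cast; ring
  simp only [latticeTheta, h1, h2]
  rw [show ∀ z u v w y m n : ℤ, z + m - (u + n) - v - w - y = (z - u - v - w - y) + (m - n) from
    fun _ _ _ _ _ _ _ => by ring, zpow_add₀ hq, zpow_sub₀ hq ((i + j + k + l : ℕ) : ℤ), zpow_natCast, zpow_natCast]
  ring

theorem latticeH_succ {q a b c d e : ℂ} (hq : q ≠ 0) (i j k l : ℕ) :
    latticeH q a b c d e (i + 1) j k l =
      latticeH q a b c d e i j k l *
        ((1 - b * q ^ i) * ((1 - b * q ^ i * (c * q ^ j) / a) * (1 - b * q ^ i * (d * q ^ k) / a) *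
          (1 - b * q ^ i * (e * q ^ l) / a)) /
        ((1 - q * q ^ (i + j + k + l)) *
          ((1 - a * q * q ^ (i + j + k + l) / (c * q ^ j)) *
            (1 - a * q * q ^ (i + j + k + l) / (d * q ^ k)) *
            (1 - a * q * q ^ (i + j + k + l) / (e * q ^ l))))) := by
  have hp : ∀ n, q ^ n ≠ 0 := fun n => pow_ne_zero n hq
  have hj : a * q * q ^ (i + j + k + l) / (c * q ^ j) = q * a / c * q ^ (i + k + l) := by
    rw [show i + j + k + l = (i + k + l) + j by ring, pow_add _ _ j, ← mul_assoc,
      mul_div_mul_right _ _ (hp j)]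
    ring
  have hk : a * q * q ^ (i + j + k + l) / (d * q ^ k) = q * a / d * q ^ (i + j + l) := by
    rw [show i + j + k + l = (i + j + l) + k by ring, pow_add _ _ k, ← mul_assoc,
      mul_div_mul_right _ _ (hp k)]
    ring
  have hl : a * q * q ^ (i + j + k + l) / (e * q ^ l) = q * a / e * q ^ (i + j + k) := by
    rw [pow_add _ _ l, ← mul_assoc, mul_div_mul_right _ _ (hp l)]
    ring
  rw [hj, hk, hl, show b * q ^ i * (c * q ^ j) / a = b * c / a * q ^ (i + j) by ring,
    show b * q ^ i * (d * q ^ k) / a = b * d / a * q ^ (i + k) by ring,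
    show b * q ^ i * (e * q ^ l) / a = b * e / a * q ^ (i + l) by ring]
  simp only [latticeH, add_right_comm _ 1 _, qPoch_succ]
  rw [div_mul_div_comm]
  congr 1 <;> ring

theorem weight_succ {q a b c d e : ℂ} (hq : q ≠ 0) (i j k l : ℕ) :
    weight q a b c d e (i + 1) j k l =
      weight q a b c d e i j k l * (a * q ^ (i + j + k + l) / (b * q ^ i) *
        ((1 - b * q ^ i) * ((1 - b * q ^ i * (c * q ^ j) / a) * (1 - b * q ^ i * (d * q ^ k) / a) *
          (1 - b * q ^ i * (e * q ^ l) / a)) /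
        ((1 - q * q ^ (i + j + k + l)) *
          ((1 - a * q * q ^ (i + j + k + l) / (c * q ^ j)) *
            (1 - a * q * q ^ (i + j + k + l) / (d * q ^ k)) *
            (1 - a * q * q ^ (i + j + k + l) / (e * q ^ l)))))) := by
  rw [weight, weight, latticeTheta_succ c d e hq, latticeH_succ hq]
  ring

/-! ### Factors depending on the truncation parameter `N` -/

/-- The factor of the truncated term that belongs to one parameter `x`. -/
def truncFactor (q a x : ℂ) (N i : ℕ) : ℂ :=
  qPoch (q * a / x) q (N - i) / (qPoch (x * q ^ N) q i * qPoch (q * a / x) q N)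

/-- The factor of the certificate that belongs to one parameter `x`. -/
def certFactor (q a x : ℂ) (N i : ℕ) : ℂ :=
  qPoch (q * a / x) q (N - i) / (qPoch (x * q ^ (N + 1)) q i * qPoch (q * a / x) q (N + 1))

theorem div_mul_pow_sub {q : ℂ} (hq : q ≠ 0) (a x : ℂ) {N i : ℕ} (h : i ≤ N) :
    q * a / x * q ^ (N - i) = a * q * q ^ N / (x * q ^ i) := by
  rw [pow_sub₀ _ hq h]
  ring

/-- Together with `mul_truncFactor`, this makes `certFactor` a common factor of the two terms of the
Wilf–Zeilberger difference, leaving only factors linear in `q^N`. -/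
theorem truncFactor_succ {q a x : ℂ} (hq : q ≠ 0) {N i : ℕ} (h : i ≤ N) :
    truncFactor q a x (N + 1) i = certFactor q a x N i * (1 - a * q * q ^ N / (x * q ^ i)) := by
  rw [truncFactor, certFactor, Nat.sub_add_comm h, qPoch_succ, div_mul_pow_sub hq a x h]
  ring

theorem mul_truncFactor {q a x : ℂ} {N i : ℕ} (hx : i = 0 ∨ ∀ n : ℕ, x * q ^ n ≠ 1) :
    (1 - x * q ^ N) / (1 - q * a / x * q ^ N) * truncFactor q a x N i =
      certFactor q a x N i * (1 - x * q ^ i * q ^ N) := by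
  have h1 := qPoch_shift_ne_zero hx N
  have h2 := qPoch_shift_ne_zero hx (N + 1)
  have h3 : qPoch (x * q ^ N) q i * (1 - x * q ^ N * q ^ i) =
      (1 - x * q ^ N) * qPoch (x * q ^ (N + 1)) q i := by
    rw [← qPoch_succ, qPoch_succ', pow_succ, mul_assoc x]
  have h4 : (1 - x * q ^ N) / qPoch (x * q ^ N) q i =
      (1 - x * q ^ i * q ^ N) / qPoch (x * q ^ (N + 1)) q i := by
    rw [div_eq_div_iff h1 h2, ← h3]
    ring
  rw [truncFactor, certFactor, qPoch_succ (q * a / x) q N, div_mul_div_comm, mul_left_comm,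
    mul_comm (qPoch (x * q ^ N) q i), ← mul_assoc, mul_comm (_ * _) (qPoch (x * q ^ N) q i),
    ← div_mul_div_comm, h4, div_mul_div_comm, div_mul_eq_mul_div]
  ring

/-- The bound keeps `N - (i + 1)` a genuine difference. At the end of the sum `i = N` can occur;
there `truncFactor_succ_succ_mul` takes over. -/
theorem certFactor_succ_mul {q a x : ℂ} (hq : q ≠ 0) {N i : ℕ} (h : i + 1 ≤ N)
    (hx : ∀ n : ℕ, x * q ^ n ≠ 1) :
    certFactor q a x N (i + 1) * ((1 - x * q ^ i * (q * q ^ N)) * (1 - a * q ^ N / (x * q ^ i))) =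
      certFactor q a x N i := by
  obtain ⟨M, rfl⟩ : ∃ M, N = M + (i + 1) := ⟨N - (i + 1), by omega⟩
  have h1 : a * q ^ (M + (i + 1)) / (x * q ^ i) = q * a / x * q ^ M := by
    have := pow_ne_zero i hq
    rw [show M + (i + 1) = (M + 1) + i by ring, pow_add _ _ i, ← mul_assoc,
      mul_div_mul_right _ _ this]
    ring
  have h2 : 1 - x * q ^ (M + (i + 1) + 1) * q ^ i ≠ 0 := by
    rw [mul_assoc, ← pow_add]
    exact sub_ne_zero.2 (hx _).symm
  rw [certFactor, certFactor, h1, show M + (i + 1) - i = M + 1 by omega,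
    show M + (i + 1) - (i + 1) = M by omega, qPoch_succ (q * a / x) q M, qPoch_succ (x * _),
    show x * q ^ i * (q * q ^ (M + (i + 1))) = x * q ^ (M + (i + 1) + 1) * q ^ i by ring]
  rw [div_mul_eq_mul_div, mul_right_comm _ (1 - x * q ^ (M + (i + 1) + 1) * q ^ i),
    mul_comm (1 - x * q ^ (M + (i + 1) + 1) * q ^ i), ← mul_assoc, mul_div_mul_right _ _ h2]

theorem truncFactor_succ_succ_mul {q a x : ℂ} {N i : ℕ} (hx : ∀ n : ℕ, x * q ^ n ≠ 1) :
    truncFactor q a x (N + 1) (i + 1) * (1 - x * q ^ i * (q * q ^ N)) = certFactor q a x N i := by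
  have h2 : 1 - x * q ^ (N + 1) * q ^ i ≠ 0 := by
    rw [mul_assoc, ← pow_add]
    exact sub_ne_zero.2 (hx _).symm
  rw [truncFactor, certFactor, qPoch_succ (x * _), Nat.add_sub_add_right,
    show x * q ^ i * (q * q ^ N) = x * q ^ (N + 1) * q ^ i by ring, div_mul_eq_mul_div,
    mul_right_comm _ (1 - x * q ^ (N + 1) * q ^ i), mul_div_mul_right _ _ h2]

end JacksonDual

/-! ### The Wilf–Zeilberger equation for a single lattice step. -/

namespace JacksonDual

/-- The term of the truncated series, without the factor that depends on the next step. -/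
def truncTerm (q a b c d e : ℂ) (N i j k l : ℕ) : ℂ :=
  weight q a b c d e i j k l * (qPoch q q N / qPoch q q (N - (i + j + k + l))) *
    qPoch (a * q ^ N) q (i + j + k + l) *
    (truncFactor q a b N i * truncFactor q a c N j * truncFactor q a d N k * truncFactor q a e N l)

/-- The Wilf–Zeilberger certificate. -/
def cert (q a b c d e : ℂ) (N i j k l : ℕ) : ℂ :=
  -(weight q a b c d e i j k l * (q * q ^ N / q ^ (i + j + k + l)) *
      ((1 - q ^ (i + j + k + l)) * qPoch (a * q ^ (N + 1)) q (i + j + k + l - 1)) *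
      (1 - a * q * (q ^ N) ^ 2) * (qPoch q q N / qPoch q q (N + 1 - (i + j + k + l))) *
      ((1 - a * q ^ (i + j + k + l) / (b * q ^ i)) * (1 - a * q ^ (i + j + k + l) / (c * q ^ j)) *
        (1 - a * q ^ (i + j + k + l) / (d * q ^ k)) * (1 - a * q ^ (i + j + k + l) / (e * q ^ l))) *
      (certFactor q a b N i * certFactor q a c N j * certFactor q a d N k * certFactor q a e N l))

/-- The quotient of consecutive values of the truncated product side. -/
def prodRatio (q a b c d e : ℂ) (N : ℕ) : ℂ :=
  (1 - b * q ^ N) / (1 - q * a / b * q ^ N) * ((1 - c * q ^ N) / (1 - q * a / c * q ^ N)) *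
    ((1 - d * q ^ N) / (1 - q * a / d * q ^ N)) * ((1 - e * q ^ N) / (1 - q * a / e * q ^ N))

/-- The factor `(1 - xqⁱY)(1 - aY/(xqⁱ))` contributed by a step of the coordinate of `x`. -/
def stepFactor (q a x : ℂ) (i : ℕ) (Y : ℂ) : ℂ :=
  (1 - x * q ^ i * Y) * (1 - a * Y / (x * q ^ i))

/-- For `n > 0` the common factor is `γ = (aqX;q)_(n-1)`. For `n = 0` it would have to be `1 / (1 -
aX)`, which need not exist, hence the second case. -/
theorem certificate_dichotomy (q a X : ℂ) (n : ℕ) :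
    (∃ γ, qPoch (a * X) q n = γ * (1 - a * X) ∧
      qPoch (a * (X * q)) q n = γ * (1 - a * q ^ n * X) ∧
      (1 - q ^ n) * qPoch (a * (X * q)) q (n - 1) = γ * (1 - q ^ n)) ∨
    (q ^ n = 1 ∧ qPoch (a * X) q n = 1 ∧ qPoch (a * (X * q)) q n = 1 ∧
      (1 - q ^ n) * qPoch (a * (X * q)) q (n - 1) = 0) := by
  rcases n with _ | n
  · right
    simp [qPoch_zero]
  · left
    refine ⟨qPoch (a * (X * q)) q n, ?_, ?_, ?_⟩
    · rw [qPoch_succ', mul_assoc, mul_comm]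
    · rw [qPoch_succ]
      ring
    · rw [Nat.add_sub_cancel, mul_comm]

/-- Multiplying `certificate_identity`, the hypothesis `h`, by the common factors gives the equation
for one step. All factors are opaque letters: `G` and `G * g` stand for `(q;q)_(N-n)` and
`(q;q)_(N+1-n)`, and `Sb`, `Sb'` for `certFactor` at `i` and `i + 1`. -/
theorem assemble_interior {w A G α₁ α₂ β Sb Sb' Sc Sd Se y yb yc yd ye z z' t t' vb vc vd ve g r P m
    uc ud ue : ℂ} (hG : G ≠ 0) (hg : g ≠ 0) (ht : t ≠ 0) (ht' : t' ≠ 0) (hyb : yb ≠ 0)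
    (hvb : vb ≠ 0) (hSb : Sb' * (t * t') = Sb)
    (h : y * α₂ * (yc * yd * ye) * z * t' - g * α₁ * t * (vc * vd * ve) * z =
      -(P * g * r * α₂) + m * β * r * (uc * ud * ue) * t * t') :
    w * (A * y / (G * g)) * α₂ * (Sb * yb * (Sc * yc) * (Sd * yd) * (Se * ye)) *
        (z * z' / (t * yb)) -
      w * (A / G) * α₁ * (Sb * vb * (Sc * vc) * (Sd * vd) * (Se * ve)) * (z * z' / (vb * t')) =
    -(w * P * z' * r * α₂ * (A / G) * (Sb' * Sc * Sd * Se)) -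
      -(w * m * β * r * (A / (G * g)) * (z' * uc * ud * ue) * (Sb * Sc * Sd * Se)) := by
  subst hSb
  calc _ = w * A / (G * g) * (Sb' * Sc * Sd * Se) * z' *
        (y * α₂ * (yc * yd * ye) * z * t' - g * α₁ * t * (vc * vd * ve) * z) := by
          field_simp
    _ = _ := by
          rw [h]
          field_simp
          ring

theorem assemble_boundary {w A α₁ α₂ β Sb Sb' Sc Sd Se y yb yc yd ye z t t' vc vd ve g r P m
    uc ud ue : ℂ} (hg : g ≠ 0) (ht : t ≠ 0) (hyb : yb ≠ 0) (hSb : Sb' * t = Sb)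
    (h : y * α₂ * (yc * yd * ye) * z * t' - g * α₁ * t * (vc * vd * ve) * z =
      -(P * g * r * α₂) + m * β * r * (uc * ud * ue) * t * t') :
    w * (A * y / g) * α₂ * (Sb * yb * (Sc * yc) * (Sd * yd) * (Se * ye)) * (z * t' / (t * yb)) -
      w * A * α₁ * (Sb * z * (Sc * vc) * (Sd * vd) * (Se * ve)) =
    -(w * P * r * α₂ * A * (Sb' * Sc * Sd * Se)) -
      -(w * m * β * r * (A / g) * (t' * uc * ud * ue) * (Sb * Sc * Sd * Se)) := by
  subst hSb
  calc _ = w * A / g * (Sb' * Sc * Sd * Se) *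
        (y * α₂ * (yc * yd * ye) * z * t' - g * α₁ * t * (vc * vd * ve) * z) := by
          field_simp
    _ = _ := by
          rw [h]
          field_simp
          ring

theorem assemble_cert_succ {w a B Q q X p v y₁ y₂ y₃ y₄ α r A z S : ℂ} (hq : q ≠ 0) (hQ : Q ≠ 0)
    (h₁ : y₁ ≠ 0) (h₂ : y₂ ≠ 0) (h₃ : y₃ ≠ 0) (h₄ : y₄ ≠ 0) :
    -(w * (a * Q / B * (v * p / (y₁ * (y₂ * y₃ * y₄)))) * (q * X / (q * Q)) * (y₁ * α) * r * A *
        (z * y₂ * y₃ * y₄) * S) =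
      -(w * (a * X / B * v * p) * z * r * α * A * S) := by
  field_simp

variable {q a b c d e : ℂ}

theorem truncTerm_succ (hq : q ≠ 0) {N i j k l : ℕ} (h : i + j + k + l ≤ N) :
    truncTerm q a b c d e (N + 1) i j k l =
      weight q a b c d e i j k l *
        (qPoch q q N * (1 - q * q ^ N) / qPoch q q (N + 1 - (i + j + k + l))) *
        qPoch (a * q ^ (N + 1)) q (i + j + k + l) *
        (certFactor q a b N i * (1 - a * q * q ^ N / (b * q ^ i)) *
          (certFactor q a c N j * (1 - a * q * q ^ N / (c * q ^ j))) *
          (certFactor q a d N k * (1 - a * q * q ^ N / (d * q ^ k))) *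
          (certFactor q a e N l * (1 - a * q * q ^ N / (e * q ^ l)))) := by
  rw [truncTerm, qPoch_succ q q N, truncFactor_succ hq (by omega), truncFactor_succ hq (by omega),
    truncFactor_succ hq (by omega), truncFactor_succ hq (by omega)]

theorem prodRatio_mul_truncTerm {N i j k l : ℕ}
    (hb : i = 0 ∨ ∀ n : ℕ, b * q ^ n ≠ 1) (hc : j = 0 ∨ ∀ n : ℕ, c * q ^ n ≠ 1)
    (hd : k = 0 ∨ ∀ n : ℕ, d * q ^ n ≠ 1) (he : l = 0 ∨ ∀ n : ℕ, e * q ^ n ≠ 1) :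
    prodRatio q a b c d e N * truncTerm q a b c d e N i j k l =
      weight q a b c d e i j k l * (qPoch q q N / qPoch q q (N - (i + j + k + l))) *
        qPoch (a * q ^ N) q (i + j + k + l) *
        (certFactor q a b N i * (1 - b * q ^ i * q ^ N) *
          (certFactor q a c N j * (1 - c * q ^ j * q ^ N)) *
          (certFactor q a d N k * (1 - d * q ^ k * q ^ N)) *
          (certFactor q a e N l * (1 - e * q ^ l * q ^ N))) := by
  rw [← mul_truncFactor hb, ← mul_truncFactor hc, ← mul_truncFactor hd, ← mul_truncFactor he,
    prodRatio, truncTerm]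
  ring

theorem one_sub_ne_zero_of_le {q y : ℂ} (hq : q ≠ 0) (h : ∀ n : ℕ, y * q ^ n ≠ 1) {x : ℂ} {m n : ℕ}
    (hmn : m ≤ n) (hx : x = y * q ^ n / q ^ m) : 1 - x ≠ 0 := by
  rw [hx, mul_div_assoc, div_eq_mul_inv, ← pow_sub₀ _ hq hmn]
  exact sub_ne_zero.2 (h _).symm

theorem cert_succ (hq : q ≠ 0) {N i j k l : ℕ} (hqq : ∀ n : ℕ, q * q ^ n ≠ 1) (hac : ∀ n : ℕ, q * a / c * q ^ n ≠ 1)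
    (had : ∀ n : ℕ, q * a / d * q ^ n ≠ 1) (hae : ∀ n : ℕ, q * a / e * q ^ n ≠ 1) :
    cert q a b c d e N (i + 1) j k l =
      -(weight q a b c d e i j k l *
        (a * q ^ N / (b * q ^ i) * (1 - b * q ^ i) *
          ((1 - b * q ^ i * (c * q ^ j) / a) * (1 - b * q ^ i * (d * q ^ k) / a) *
            (1 - b * q ^ i * (e * q ^ l) / a))) *
        (1 - a * q ^ (i + j + k + l) / (b * q ^ i)) * (1 - a * q * (q ^ N) ^ 2) *
        qPoch (a * q ^ (N + 1)) q (i + j + k + l) * (qPoch q q N / qPoch q q (N - (i + j + k + l))) *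
        (certFactor q a b N (i + 1) * certFactor q a c N j * certFactor q a d N k *
          certFactor q a e N l)) := by
  have n1 : 1 - q * q ^ (i + j + k + l) ≠ 0 := sub_ne_zero.2 (hqq _).symm
  have n2 : 1 - a * q * q ^ (i + j + k + l) / (c * q ^ j) ≠ 0 :=
    one_sub_ne_zero_of_le hq hac (m := j) (n := i + j + k + l) (by omega) (by ring)
  have n3 : 1 - a * q * q ^ (i + j + k + l) / (d * q ^ k) ≠ 0 :=
    one_sub_ne_zero_of_le hq had (m := k) (n := i + j + k + l) (by omega) (by ring)
  have n4 : 1 - a * q * q ^ (i + j + k + l) / (e * q ^ l) ≠ 0 :=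
    one_sub_ne_zero_of_le hq hae (m := l) (n := i + j + k + l) (by omega) (by ring)
  have e1 : a * q ^ (i + 1 + j + k + l) / (b * q ^ (i + 1)) =
      a * q ^ (i + j + k + l) / (b * q ^ i) := by
    rw [show i + 1 + j + k + l = i + j + k + l + 1 by ring, pow_succ, pow_succ, ← mul_assoc,
      ← mul_assoc, mul_div_mul_right _ _ hq]
  have e2 : ∀ x y : ℂ, a * q ^ (i + j + k + l + 1) / (x * y) =
      a * q * q ^ (i + j + k + l) / (x * y) := fun x y => by ring
  have e3 : q ^ (i + j + k + l + 1) = q * q ^ (i + j + k + l) := pow_succ' _ _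
  have hQ : q ^ (i + j + k + l) ≠ 0 := pow_ne_zero _ hq
  rw [cert, weight_succ hq, e1]
  simp only [add_right_comm _ 1 _, Nat.add_sub_add_right, Nat.add_sub_cancel]
  rw [e2, e2, e2, e3]
  exact assemble_cert_succ hq hQ n1 n2 n3 n4

theorem truncTerm_wz (hq : q ≠ 0) (ha : a ≠ 0) (hb : b ≠ 0) (hc : c ≠ 0) (hd : d ≠ 0) (he : e ≠ 0)
    (hrel : b * c * d * e = q * a ^ 2) (hqq : ∀ n : ℕ, q * q ^ n ≠ 1)
    (hab : ∀ n : ℕ, q * a / b * q ^ n ≠ 1) (hac : ∀ n : ℕ, q * a / c * q ^ n ≠ 1)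
    (had : ∀ n : ℕ, q * a / d * q ^ n ≠ 1) (hae : ∀ n : ℕ, q * a / e * q ^ n ≠ 1)
    {N i j k l : ℕ} (hN : i + j + k + l < N)
    (hbi : ∀ n : ℕ, b * q ^ n ≠ 1) (hcj : j = 0 ∨ ∀ n : ℕ, c * q ^ n ≠ 1)
    (hdk : k = 0 ∨ ∀ n : ℕ, d * q ^ n ≠ 1) (hel : l = 0 ∨ ∀ n : ℕ, e * q ^ n ≠ 1) :
    truncTerm q a b c d e (N + 1) i j k l *
        (stepFactor q a b i (q ^ (i + j + k + l)) / stepFactor q a b i (q ^ (N + 1))) -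
      prodRatio q a b c d e N * (truncTerm q a b c d e N i j k l *
        (stepFactor q a b i (q ^ (i + j + k + l)) / stepFactor q a b i (q ^ N))) =
      cert q a b c d e N (i + 1) j k l - cert q a b c d e N i j k l := by
  have hdich := certificate_dichotomy q a (q ^ N) (i + j + k + l)
  have hG : qPoch q q (N + 1 - (i + j + k + l)) =
      qPoch q q (N - (i + j + k + l)) * (1 - q * q ^ N / q ^ (i + j + k + l)) := by
    rw [Nat.sub_add_comm hN.le, qPoch_succ, pow_sub₀ _ hq hN.le]
    ring
  have hGne := qPoch_ne_zero hqq (N + 1 - (i + j + k + l))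
  have hG'ne := qPoch_ne_zero hqq (N - (i + j + k + l))
  have hrel' : b * q ^ i * (c * q ^ j) * (d * q ^ k) * (e * q ^ l) =
      q * a ^ 2 * q ^ (i + j + k + l) := by
    rw [pow_add, pow_add, pow_add, ← hrel]
    ring
  have hcertb := certFactor_succ_mul (N := N) (i := i) (a := a) hq (by omega) hbi
  have n1 : 1 - q * q ^ (i + j + k + l) ≠ 0 := sub_ne_zero.2 (hqq _).symm
  have n2 : 1 - a * q * q ^ (i + j + k + l) / (c * q ^ j) ≠ 0 :=
    one_sub_ne_zero_of_le hq hac (m := j) (n := i + j + k + l) (by omega) (by ring)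
  have n3 : 1 - a * q * q ^ (i + j + k + l) / (d * q ^ k) ≠ 0 :=
    one_sub_ne_zero_of_le hq had (m := k) (n := i + j + k + l) (by omega) (by ring)
  have n4 : 1 - a * q * q ^ (i + j + k + l) / (e * q ^ l) ≠ 0 :=
    one_sub_ne_zero_of_le hq hae (m := l) (n := i + j + k + l) (by omega) (by ring)
  have n5 : 1 - a * q * q ^ N / (b * q ^ i) ≠ 0 :=
    one_sub_ne_zero_of_le hq hab (m := i) (n := N) (by omega) (by ring)
  -- This factor is `1 - (qa/b) q^(N-i-1)`, so the strict inequality `i + j + k + l < N` is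
  -- essential.
  have n6 : 1 - a * q ^ N / (b * q ^ i) ≠ 0 := by
    refine one_sub_ne_zero_of_le hq hab (m := i + 1) (n := N) (by omega) ?_
    rw [pow_succ]
    field_simp
  have n7 : 1 - b * q ^ i * (q * q ^ N) ≠ 0 := by
    rw [show b * q ^ i * (q * q ^ N) = b * q ^ (i + (N + 1)) by ring]
    exact sub_ne_zero.2 (hbi _).symm
  have n8 : 1 - b * q ^ i * q ^ N ≠ 0 := by
    rw [mul_assoc, ← pow_add]
    exact sub_ne_zero.2 (hbi _).symm
  have hT := prodRatio_mul_truncTerm (a := a) (N := N) (Or.inr hbi : i = 0 ∨ _) hcj hdk hel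
  rw [truncTerm_succ hq hN.le, ← mul_assoc (prodRatio _ _ _ _ _ _ _), hT,
    cert_succ hq hqq hac had hae, cert, hG, stepFactor, stepFactor, stepFactor,
    pow_succ' q N, show ∀ x : ℂ, a * (q * q ^ N) / x = a * q * q ^ N / x from fun x => by ring]
  have hcore := certificate_identity (X := q ^ N) ha (mul_ne_zero hb (pow_ne_zero i hq))
    (mul_ne_zero hc (pow_ne_zero j hq)) (mul_ne_zero hd (pow_ne_zero k hq))
    (mul_ne_zero he (pow_ne_zero l hq)) (pow_ne_zero (i + j + k + l) hq) hrel'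
    hdich
  rw [mul_comm (q ^ N) q, mul_assoc (b * q ^ i) q] at hcore
  exact assemble_interior hG'ne (right_ne_zero_of_mul (hG ▸ hGne)) n7 n6 n5 n8 hcertb hcore

theorem assemble_truncTerm_succ {w s y₁ y₂ y₃ y₄ v p r α A S₁ S₂ S₃ S₄ : ℂ}
    (h₁ : y₁ ≠ 0) (h₂ : y₂ ≠ 0) (h₃ : y₃ ≠ 0) (h₄ : y₄ ≠ 0) :
    w * (s * (v * p / (y₁ * (y₂ * y₃ * y₄)))) * (A * y₁ / 1) * (α * r) *
        (S₁ * (S₂ * y₂) * (S₃ * y₃) * (S₄ * y₄)) =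
      w * (s * v * p) * r * α * A * (S₁ * S₂ * S₃ * S₄) := by
  field_simp

/-- The end of the telescoping sum: passing from `N` to `N + 1` replaces the end term by a summand
with a step quotient and a new end term, whose negative takes the place of `cert` at the next
lattice point. -/
theorem truncTerm_wz_boundary (hq : q ≠ 0) (ha : a ≠ 0) (hb : b ≠ 0) (hc : c ≠ 0) (hd : d ≠ 0)
    (he : e ≠ 0) (hrel : b * c * d * e = q * a ^ 2) (hqq : ∀ n : ℕ, q * q ^ n ≠ 1)
    (hab : ∀ n : ℕ, q * a / b * q ^ n ≠ 1) (hac : ∀ n : ℕ, q * a / c * q ^ n ≠ 1)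
    (had : ∀ n : ℕ, q * a / d * q ^ n ≠ 1) (hae : ∀ n : ℕ, q * a / e * q ^ n ≠ 1)
    {N i j k l : ℕ} (hN : i + j + k + l = N)
    (hbi : ∀ n : ℕ, b * q ^ n ≠ 1) (hcj : j = 0 ∨ ∀ n : ℕ, c * q ^ n ≠ 1)
    (hdk : k = 0 ∨ ∀ n : ℕ, d * q ^ n ≠ 1) (hel : l = 0 ∨ ∀ n : ℕ, e * q ^ n ≠ 1) :
    truncTerm q a b c d e (N + 1) i j k l *
        (stepFactor q a b i (q ^ N) / stepFactor q a b i (q ^ (N + 1))) -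
      prodRatio q a b c d e N * truncTerm q a b c d e N i j k l =
      -truncTerm q a b c d e (N + 1) (i + 1) j k l - cert q a b c d e N i j k l := by
  have hQ : q ^ (i + j + k + l) = q ^ N := by rw [hN]
  have hdich := certificate_dichotomy q a (q ^ N) N
  have hrel' : b * q ^ i * (c * q ^ j) * (d * q ^ k) * (e * q ^ l) = q * a ^ 2 * q ^ N := by
    rw [← hQ, pow_add, pow_add, pow_add, ← hrel]
    ring
  have hX : q ^ N ≠ 0 := pow_ne_zero _ hq
  have hSb := truncFactor_succ_succ_mul (N := N) (i := i) (a := a) hbi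
  have n0 : 1 - q ≠ 0 := by simpa using sub_ne_zero.2 (hqq 0).symm
  have n1 : 1 - q * q ^ N ≠ 0 := sub_ne_zero.2 (hqq _).symm
  have n2 : 1 - a * q * q ^ N / (c * q ^ j) ≠ 0 :=
    one_sub_ne_zero_of_le hq hac (m := j) (n := N) (by omega) (by ring)
  have n3 : 1 - a * q * q ^ N / (d * q ^ k) ≠ 0 :=
    one_sub_ne_zero_of_le hq had (m := k) (n := N) (by omega) (by ring)
  have n4 : 1 - a * q * q ^ N / (e * q ^ l) ≠ 0 :=
    one_sub_ne_zero_of_le hq hae (m := l) (n := N) (by omega) (by ring)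
  have n5 : 1 - a * q * q ^ N / (b * q ^ i) ≠ 0 :=
    one_sub_ne_zero_of_le hq hab (m := i) (n := N) (by omega) (by ring)
  have n7 : 1 - b * q ^ i * (q * q ^ N) ≠ 0 := by
    rw [show b * q ^ i * (q * q ^ N) = b * q ^ (i + (N + 1)) by ring]
    exact sub_ne_zero.2 (hbi _).symm
  have hnext : truncTerm q a b c d e (N + 1) (i + 1) j k l =
      weight q a b c d e i j k l *
        (a * q ^ N / (b * q ^ i) * (1 - b * q ^ i) *
          ((1 - b * q ^ i * (c * q ^ j) / a) * (1 - b * q ^ i * (d * q ^ k) / a) *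
            (1 - b * q ^ i * (e * q ^ l) / a))) *
        (1 - a * q * (q ^ N) ^ 2) * qPoch (a * q ^ (N + 1)) q N * qPoch q q N *
        (truncFactor q a b (N + 1) (i + 1) * certFactor q a c N j * certFactor q a d N k *
          certFactor q a e N l) := by
    rw [truncTerm, weight_succ hq, truncFactor_succ hq (x := c) (by omega),
      truncFactor_succ hq (x := d) (by omega), truncFactor_succ hq (x := e) (by omega), hQ,
      show i + 1 + j + k + l = N + 1 by omega, Nat.sub_self, qPoch_zero, qPoch_succ q q N,
      qPoch_succ _ _ N, show a * q ^ (N + 1) * q ^ N = a * q * (q ^ N) ^ 2 by ring]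
    exact assemble_truncTerm_succ n1 n2 n3 n4
  have hT := prodRatio_mul_truncTerm (a := a) (N := N) (Or.inr hbi : i = 0 ∨ _) hcj hdk hel
  rw [truncTerm_succ hq hN.le, hT, hnext, cert, hN, Nat.sub_self, qPoch_zero, div_one,
    Nat.add_sub_cancel_left, stepFactor, stepFactor, pow_succ' q N,
    show ∀ x : ℂ, a * (q * q ^ N) / x = a * q * q ^ N / x from fun x => by ring,
    show qPoch q q 1 = 1 - q by simp [qPoch], mul_div_cancel_right₀ q hX]
  have hcore := certificate_identity (X := q ^ N) ha (mul_ne_zero hb (pow_ne_zero i hq))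
    (mul_ne_zero hc (pow_ne_zero j hq)) (mul_ne_zero hd (pow_ne_zero k hq))
    (mul_ne_zero he (pow_ne_zero l hq)) hX hrel' hdich
  rw [mul_comm (q ^ N) q, mul_assoc (b * q ^ i) q, mul_div_cancel_right₀ q hX] at hcore
  exact assemble_boundary n0 n7 n5 hSb hcore

/-! ### Symmetry in the four parameters -/

theorem weight_swap_bc (q a b c d e : ℂ) (i j k l : ℕ) :
    weight q a c b d e j i k l = weight q a b c d e i j k l := by
  rw [weight, weight, latticeTheta_swap_bc, latticeH_swap_bc]

theorem weight_swap_bd (q a b c d e : ℂ) (i j k l : ℕ) :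
    weight q a d c b e k j i l = weight q a b c d e i j k l := by
  rw [weight, weight, latticeTheta_swap_bd, latticeH_swap_bd]

theorem weight_swap_be (q a b c d e : ℂ) (i j k l : ℕ) :
    weight q a e c d b l j k i = weight q a b c d e i j k l := by
  rw [weight, weight, latticeTheta_swap_be, latticeH_swap_be]

theorem truncTerm_swap_bc (q a b c d e : ℂ) (N i j k l : ℕ) :
    truncTerm q a c b d e N j i k l = truncTerm q a b c d e N i j k l := by
  rw [truncTerm, truncTerm, weight_swap_bc, show j + i + k + l = i + j + k + l by ring]
  ring

theorem truncTerm_swap_bd (q a b c d e : ℂ) (N i j k l : ℕ) :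
    truncTerm q a d c b e N k j i l = truncTerm q a b c d e N i j k l := by
  rw [truncTerm, truncTerm, weight_swap_bd, show k + j + i + l = i + j + k + l by ring]
  ring

theorem truncTerm_swap_be (q a b c d e : ℂ) (N i j k l : ℕ) :
    truncTerm q a e c d b N l j k i = truncTerm q a b c d e N i j k l := by
  rw [truncTerm, truncTerm, weight_swap_be, show l + j + k + i = i + j + k + l by ring]
  ring

theorem cert_swap_bc (q a b c d e : ℂ) (N i j k l : ℕ) :
    cert q a c b d e N j i k l = cert q a b c d e N i j k l := by
  rw [cert, cert, weight_swap_bc, show j + i + k + l = i + j + k + l by ring]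
  ring

theorem cert_swap_bd (q a b c d e : ℂ) (N i j k l : ℕ) :
    cert q a d c b e N k j i l = cert q a b c d e N i j k l := by
  rw [cert, cert, weight_swap_bd, show k + j + i + l = i + j + k + l by ring]
  ring

theorem cert_swap_be (q a b c d e : ℂ) (N i j k l : ℕ) :
    cert q a e c d b N l j k i = cert q a b c d e N i j k l := by
  rw [cert, cert, weight_swap_be, show l + j + k + i = i + j + k + l by ring]
  ring

theorem prodRatio_swap_bc (q a b c d e : ℂ) (N : ℕ) :
    prodRatio q a c b d e N = prodRatio q a b c d e N := by
  rw [prodRatio, prodRatio]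
  ring

theorem prodRatio_swap_bd (q a b c d e : ℂ) (N : ℕ) :
    prodRatio q a d c b e N = prodRatio q a b c d e N := by
  rw [prodRatio, prodRatio]
  ring

theorem prodRatio_swap_be (q a b c d e : ℂ) (N : ℕ) :
    prodRatio q a e c d b N = prodRatio q a b c d e N := by
  rw [prodRatio, prodRatio]
  ring

end JacksonDual

/-! ### Telescoping along a lattice path. -/

namespace JacksonDual

/-- Parameters and a monotone lattice path `m ↦ (i m, j m, k m, l m)` from the origin with unit
steps, such that the denominators of the truncated series do not vanish. -/
structure Admissible (q a b c d e : ℂ) (i j k l : ℕ → ℕ) : Prop where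
  hq : q ≠ 0
  ha : a ≠ 0
  hb : b ≠ 0
  hc : c ≠ 0
  hd : d ≠ 0
  he : e ≠ 0
  rel : b * c * d * e = q * a ^ 2
  hqq : ∀ n : ℕ, q * q ^ n ≠ 1
  hab : ∀ n : ℕ, q * a / b * q ^ n ≠ 1
  hac : ∀ n : ℕ, q * a / c * q ^ n ≠ 1
  had : ∀ n : ℕ, q * a / d * q ^ n ≠ 1
  hae : ∀ n : ℕ, q * a / e * q ^ n ≠ 1
  hbi : (∀ m, i m = 0) ∨ ∀ n : ℕ, b * q ^ n ≠ 1
  hcj : (∀ m, j m = 0) ∨ ∀ n : ℕ, c * q ^ n ≠ 1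
  hdk : (∀ m, k m = 0) ∨ ∀ n : ℕ, d * q ^ n ≠ 1
  hel : (∀ m, l m = 0) ∨ ∀ n : ℕ, e * q ^ n ≠ 1
  sum_eq : ∀ m, i m + j m + k m + l m = m
  mono_i : Monotone i
  mono_j : Monotone j
  mono_k : Monotone k
  mono_l : Monotone l

/-- The product of the step factors of all coordinates that change in the `m`-th step. -/
def stepProd (q a b c d e : ℂ) (i j k l : ℕ → ℕ) (m : ℕ) (Y : ℂ) : ℂ :=
  (∏ s ∈ Finset.Ico (i m) (i (m + 1)), stepFactor q a b s Y) *
    (∏ s ∈ Finset.Ico (j m) (j (m + 1)), stepFactor q a c s Y) *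
    (∏ s ∈ Finset.Ico (k m) (k (m + 1)), stepFactor q a d s Y) *
    (∏ s ∈ Finset.Ico (l m) (l (m + 1)), stepFactor q a e s Y)

/-- The truncated product side. -/
def prodTrunc (q a b c d e : ℂ) (N : ℕ) : ℂ :=
  qPoch b q N / qPoch (q * a / b) q N * (qPoch c q N / qPoch (q * a / c) q N) *
    (qPoch d q N / qPoch (q * a / d) q N) * (qPoch e q N / qPoch (q * a / e) q N)

theorem prodTrunc_succ (q a b c d e : ℂ) (N : ℕ) :
    prodTrunc q a b c d e (N + 1) = prodRatio q a b c d e N * prodTrunc q a b c d e N := by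
  simp only [prodTrunc, prodRatio, qPoch_succ, mul_div_mul_comm]
  ring

theorem stepProd_swap_bc (q a b c d e : ℂ) (i j k l : ℕ → ℕ) :
    stepProd q a c b d e j i k l = stepProd q a b c d e i j k l := by
  ext m Y
  rw [stepProd, stepProd]
  ring

theorem stepProd_swap_bd (q a b c d e : ℂ) (i j k l : ℕ → ℕ) :
    stepProd q a d c b e k j i l = stepProd q a b c d e i j k l := by
  ext m Y
  rw [stepProd, stepProd]
  ring

theorem stepProd_swap_be (q a b c d e : ℂ) (i j k l : ℕ → ℕ) :
    stepProd q a e c d b l j k i = stepProd q a b c d e i j k l := by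
  ext m Y
  rw [stepProd, stepProd]
  ring

namespace Admissible

variable {q a b c d e : ℂ} {i j k l : ℕ → ℕ}

theorem swap_bc (h : Admissible q a b c d e i j k l) : Admissible q a c b d e j i k l where
  hq := h.hq
  ha := h.ha
  hb := h.hc
  hc := h.hb
  hd := h.hd
  he := h.he
  rel := by rw [← h.rel]; ring
  hqq := h.hqq
  hab := h.hac
  hac := h.hab
  had := h.had
  hae := h.hae
  hbi := h.hcj
  hcj := h.hbi
  hdk := h.hdk
  hel := h.hel
  sum_eq m := by have := h.sum_eq m; omega
  mono_i := h.mono_j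
  mono_j := h.mono_i
  mono_k := h.mono_k
  mono_l := h.mono_l

theorem swap_bd (h : Admissible q a b c d e i j k l) : Admissible q a d c b e k j i l where
  hq := h.hq
  ha := h.ha
  hb := h.hd
  hc := h.hc
  hd := h.hb
  he := h.he
  rel := by rw [← h.rel]; ring
  hqq := h.hqq
  hab := h.had
  hac := h.hac
  had := h.hab
  hae := h.hae
  hbi := h.hdk
  hcj := h.hcj
  hdk := h.hbi
  hel := h.hel
  sum_eq m := by have := h.sum_eq m; omega
  mono_i := h.mono_k
  mono_j := h.mono_j
  mono_k := h.mono_i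
  mono_l := h.mono_l

theorem swap_be (h : Admissible q a b c d e i j k l) : Admissible q a e c d b l j k i where
  hq := h.hq
  ha := h.ha
  hb := h.he
  hc := h.hc
  hd := h.hd
  he := h.hb
  rel := by rw [← h.rel]; ring
  hqq := h.hqq
  hab := h.hae
  hac := h.hac
  had := h.had
  hae := h.hab
  hbi := h.hel
  hcj := h.hcj
  hdk := h.hdk
  hel := h.hbi
  sum_eq m := by have := h.sum_eq m; omega
  mono_i := h.mono_l
  mono_j := h.mono_j
  mono_k := h.mono_k
  mono_l := h.mono_i

theorem step_cases (h : Admissible q a b c d e i j k l) (m : ℕ) :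
    i (m + 1) = i m + 1 ∨ j (m + 1) = j m + 1 ∨ k (m + 1) = k m + 1 ∨ l (m + 1) = l m + 1 := by
  have := h.sum_eq m
  have := h.sum_eq (m + 1)
  have := h.mono_i m.le_succ
  have := h.mono_j m.le_succ
  have := h.mono_k m.le_succ
  have := h.mono_l m.le_succ
  simp only [Nat.succ_eq_add_one] at *
  omega

theorem eq_of_step (h : Admissible q a b c d e i j k l) {m : ℕ} (hm : i (m + 1) = i m + 1) :
    j (m + 1) = j m ∧ k (m + 1) = k m ∧ l (m + 1) = l m := by
  have := h.sum_eq m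
  have := h.sum_eq (m + 1)
  have := h.mono_j m.le_succ
  have := h.mono_k m.le_succ
  have := h.mono_l m.le_succ
  simp only [Nat.succ_eq_add_one] at *
  omega

theorem not_zero_of_step (h : Admissible q a b c d e i j k l) {m : ℕ}
    (hm : i (m + 1) = i m + 1) (n : ℕ) : b * q ^ n ≠ 1 :=
  h.hbi.resolve_left (fun h0 => by simp [h0] at hm) n

theorem stepProd_eq (h : Admissible q a b c d e i j k l) {m : ℕ} (hm : i (m + 1) = i m + 1) :
    stepProd q a b c d e i j k l m = stepFactor q a b (i m) := by
  obtain ⟨h1, h2, h3⟩ := h.eq_of_step hm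
  ext Y
  simp [stepProd, hm, h1, h2, h3]

theorem wz_of_step (h : Admissible q a b c d e i j k l) {m N : ℕ} (hmN : m < N)
    (hm : i (m + 1) = i m + 1) :
    truncTerm q a b c d e (N + 1) (i m) (j m) (k m) (l m) *
        (stepProd q a b c d e i j k l m (q ^ m) / stepProd q a b c d e i j k l m (q ^ (N + 1))) -
      prodRatio q a b c d e N * (truncTerm q a b c d e N (i m) (j m) (k m) (l m) *
        (stepProd q a b c d e i j k l m (q ^ m) / stepProd q a b c d e i j k l m (q ^ N))) =
      cert q a b c d e N (i (m + 1)) (j (m + 1)) (k (m + 1)) (l (m + 1)) -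
        cert q a b c d e N (i m) (j m) (k m) (l m) := by
  obtain ⟨h1, h2, h3⟩ := h.eq_of_step hm
  have := truncTerm_wz h.hq h.ha h.hb h.hc h.hd h.he h.rel h.hqq h.hab h.hac h.had h.hae
    (i := i m) (j := j m) (k := k m) (l := l m) (N := N) (by rw [h.sum_eq]; exact hmN)
    (h.not_zero_of_step hm) (h.hcj.imp_left fun h => h m) (h.hdk.imp_left fun h => h m)
    (h.hel.imp_left fun h => h m)
  rw [h.sum_eq] at this
  rw [h.stepProd_eq hm, hm, h1, h2, h3, this]

/-- Exchanging the parameter of the moving coordinate with `b` changes none of the quantities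
involved, so the step may be assumed to be in the direction of `b`. -/
theorem wz (h : Admissible q a b c d e i j k l) {m N : ℕ} (hmN : m < N) :
    truncTerm q a b c d e (N + 1) (i m) (j m) (k m) (l m) *
        (stepProd q a b c d e i j k l m (q ^ m) / stepProd q a b c d e i j k l m (q ^ (N + 1))) -
      prodRatio q a b c d e N * (truncTerm q a b c d e N (i m) (j m) (k m) (l m) *
        (stepProd q a b c d e i j k l m (q ^ m) / stepProd q a b c d e i j k l m (q ^ N))) =
      cert q a b c d e N (i (m + 1)) (j (m + 1)) (k (m + 1)) (l (m + 1)) -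
        cert q a b c d e N (i m) (j m) (k m) (l m) := by
  rcases h.step_cases m with hm | hm | hm | hm
  · exact h.wz_of_step hmN hm
  · simpa only [truncTerm_swap_bc, stepProd_swap_bc, prodRatio_swap_bc, cert_swap_bc] using
      h.swap_bc.wz_of_step hmN hm
  · simpa only [truncTerm_swap_bd, stepProd_swap_bd, prodRatio_swap_bd, cert_swap_bd] using
      h.swap_bd.wz_of_step hmN hm
  · simpa only [truncTerm_swap_be, stepProd_swap_be, prodRatio_swap_be, cert_swap_be] using
      h.swap_be.wz_of_step hmN hm

theorem wz_boundary_of_step (h : Admissible q a b c d e i j k l) {N : ℕ}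
    (hm : i (N + 1) = i N + 1) :
    truncTerm q a b c d e (N + 1) (i N) (j N) (k N) (l N) *
        (stepProd q a b c d e i j k l N (q ^ N) / stepProd q a b c d e i j k l N (q ^ (N + 1))) -
      prodRatio q a b c d e N * truncTerm q a b c d e N (i N) (j N) (k N) (l N) =
      -truncTerm q a b c d e (N + 1) (i (N + 1)) (j (N + 1)) (k (N + 1)) (l (N + 1)) -
        cert q a b c d e N (i N) (j N) (k N) (l N) := by
  obtain ⟨h1, h2, h3⟩ := h.eq_of_step hm
  have := truncTerm_wz_boundary h.hq h.ha h.hb h.hc h.hd h.he h.rel h.hqq h.hab h.hac h.had h.hae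
    (h.sum_eq N) (h.not_zero_of_step hm) (h.hcj.imp_left fun h => h N)
    (h.hdk.imp_left fun h => h N) (h.hel.imp_left fun h => h N)
  rw [h.stepProd_eq hm, hm, h1, h2, h3, this]

theorem wz_boundary (h : Admissible q a b c d e i j k l) (N : ℕ) :
    truncTerm q a b c d e (N + 1) (i N) (j N) (k N) (l N) *
        (stepProd q a b c d e i j k l N (q ^ N) / stepProd q a b c d e i j k l N (q ^ (N + 1))) -
      prodRatio q a b c d e N * truncTerm q a b c d e N (i N) (j N) (k N) (l N) =
      -truncTerm q a b c d e (N + 1) (i (N + 1)) (j (N + 1)) (k (N + 1)) (l (N + 1)) -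
        cert q a b c d e N (i N) (j N) (k N) (l N) := by
  rcases h.step_cases N with hm | hm | hm | hm
  · exact h.wz_boundary_of_step hm
  · simpa only [truncTerm_swap_bc, stepProd_swap_bc, prodRatio_swap_bc, cert_swap_bc] using
      h.swap_bc.wz_boundary_of_step hm
  · simpa only [truncTerm_swap_bd, stepProd_swap_bd, prodRatio_swap_bd, cert_swap_bd] using
      h.swap_bd.wz_boundary_of_step hm
  · simpa only [truncTerm_swap_be, stepProd_swap_be, prodRatio_swap_be, cert_swap_be] using
      h.swap_be.wz_boundary_of_step hm

/-- The truncated form of the series identity. -/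
theorem sum_truncTerm (h : Admissible q a b c d e i j k l) (N : ℕ) :
    (∑ m ∈ Finset.range N, truncTerm q a b c d e N (i m) (j m) (k m) (l m) *
        (stepProd q a b c d e i j k l m (q ^ m) / stepProd q a b c d e i j k l m (q ^ N))) +
      truncTerm q a b c d e N (i N) (j N) (k N) (l N) = prodTrunc q a b c d e N := by
  induction N with
  | zero =>
    obtain ⟨h1, h2, h3, h4⟩ : i 0 = 0 ∧ j 0 = 0 ∧ k 0 = 0 ∧ l 0 = 0 := by
      have := h.sum_eq 0
      omega
    simp [prodTrunc, truncTerm, truncFactor, weight, latticeTheta, latticeH, h1, h2, h3, h4,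
      qPoch_zero]
  | succ N ih =>
    -- At the origin the factor `1 - q^0` vanishes, so the truncated exponent `0 - 1` in `cert` is
    -- harmless.
    have h0 : cert q a b c d e N (i 0) (j 0) (k 0) (l 0) = 0 := by
      simp [cert, h.sum_eq 0]
    have htel := Finset.sum_congr rfl
      fun m hm => h.wz (m := m) (N := N) (Finset.mem_range.1 hm)
    rw [Finset.sum_range_sub (fun m => cert q a b c d e N (i m) (j m) (k m) (l m)),
      Finset.sum_sub_distrib, ← Finset.mul_sum, h0] at htel
    rw [prodTrunc_succ, ← ih, Finset.sum_range_succ]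
    -- The telescoped sum leaves `cert` at the `N`-th point of the path, which the boundary equation
    -- cancels.
    linear_combination htel + h.wz_boundary N

end Admissible

end JacksonDual

namespace JacksonDual

open Filter Topology Asymptotics

/-! ### Bounds and limits of shifted factorials -/

theorem tendsto_qPoch (x : ℂ) {q : ℂ} (hq : ‖q‖ < 1) :
    Tendsto (qPoch x q) atTop (𝓝 (qPochInf x q)) :=
  (multipliable_qPochInf x q hq).hasProd.tendsto_prod_nat

theorem qPochInf_ne_zero {x q : ℂ} (hq : ‖q‖ < 1) (h : ∀ n : ℕ, x * q ^ n ≠ 1) :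
    qPochInf x q ≠ 0 := by
  have hs : Summable (fun k : ℕ => ‖-(x * q ^ k)‖) := by
    simpa [norm_mul, norm_pow] using
      (summable_geometric_of_lt_one (norm_nonneg q) hq).mul_left ‖x‖
  have := tprod_one_add_ne_zero_of_summable (f := fun k : ℕ => -(x * q ^ k))
    (fun k => by rw [← sub_eq_add_neg]; exact sub_ne_zero.2 (h k).symm) hs
  simpa [qPochInf, sub_eq_add_neg] using this

theorem continuous_qPoch (q : ℂ) (n : ℕ) : Continuous fun x => qPoch x q n := by
  unfold qPoch
  fun_prop

theorem tendsto_qPoch_mul_pow (x : ℂ) {q : ℂ} (hq : ‖q‖ < 1) (n : ℕ) :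
    Tendsto (fun N => qPoch (x * q ^ N) q n) atTop (𝓝 1) := by
  have h0 : Tendsto (fun N => x * q ^ N) atTop (𝓝 0) := by
    simpa using (tendsto_pow_atTop_nhds_zero_of_norm_lt_one hq).const_mul x
  simpa [qPoch, Function.comp_def] using ((continuous_qPoch q n).tendsto 0).comp h0

theorem norm_qPoch_le (x : ℂ) {q : ℂ} (hq : ‖q‖ < 1) (n : ℕ) :
    ‖qPoch x q n‖ ≤ Real.exp (‖x‖ * (1 - ‖q‖)⁻¹) := by
  rw [qPoch, norm_prod]
  calc ∏ k ∈ Finset.range n, ‖1 - x * q ^ k‖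
      ≤ ∏ k ∈ Finset.range n, Real.exp (‖x‖ * ‖q‖ ^ k) := by
        refine Finset.prod_le_prod (fun _ _ => norm_nonneg _) fun k _ => ?_
        calc ‖1 - x * q ^ k‖ ≤ ‖(1 : ℂ)‖ + ‖x * q ^ k‖ := norm_sub_le _ _
          _ = ‖x‖ * ‖q‖ ^ k + 1 := by rw [norm_one, norm_mul, norm_pow, add_comm]
          _ ≤ _ := Real.add_one_le_exp _
    _ = Real.exp (‖x‖ * ∑ k ∈ Finset.range n, ‖q‖ ^ k) := by
        rw [← Real.exp_sum, Finset.mul_sum]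
    _ ≤ _ := by
        gcongr
        rw [← tsum_geometric_of_lt_one (norm_nonneg q) hq]
        exact (summable_geometric_of_lt_one (norm_nonneg q) hq).sum_le_tsum _
          fun _ _ => by positivity

variable {α : Type*} {l : Filter α}

theorem isBigO_qPoch (x : ℂ) {q : ℂ} (hq : ‖q‖ < 1) (f : α → ℕ) :
    (fun s => qPoch x q (f s)) =O[l] (fun _ => (1 : ℝ)) :=
  .of_bound _ (.of_forall fun s => by simpa using norm_qPoch_le x hq (f s))

theorem isBigO_qPoch_mul_pow (x : ℂ) {q : ℂ} (hq : ‖q‖ < 1) (f g : α → ℕ) :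
    (fun s => qPoch (x * q ^ g s) q (f s)) =O[l] (fun _ => (1 : ℝ)) := by
  refine .of_bound (Real.exp (‖x‖ * (1 - ‖q‖)⁻¹)) (.of_forall fun s => ?_)
  rw [norm_one, mul_one]
  refine (norm_qPoch_le _ hq _).trans (Real.exp_le_exp.2 ?_)
  have : 0 ≤ (1 - ‖q‖)⁻¹ := inv_nonneg.2 (sub_nonneg.2 hq.le)
  refine mul_le_mul_of_nonneg_right ?_ this
  rw [norm_mul, norm_pow]
  exact mul_le_of_le_one_right (norm_nonneg x) (pow_le_one₀ (norm_nonneg q) hq.le)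

/-- The finite products tend to a nonzero limit, so their inverses converge and hence are bounded.
-/
theorem isBigO_inv_qPoch {x q : ℂ} (hq : ‖q‖ < 1) (h : ∀ n : ℕ, x * q ^ n ≠ 1) (f : α → ℕ) :
    (fun s => (qPoch x q (f s))⁻¹) =O[l] (fun _ => (1 : ℝ)) := by
  have hb : Bornology.IsBounded (Set.range fun n => (qPoch x q n)⁻¹) :=
    Metric.isBounded_range_of_tendsto _ ((tendsto_qPoch x hq).inv₀ (qPochInf_ne_zero hq h))
  obtain ⟨C, hC⟩ := hb.exists_norm_le
  exact .of_bound C (.of_forall fun s => by simpa using hC _ ⟨f s, rfl⟩)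

/-- Uniformity in the shift comes from `(x q^g;q)_f = (x;q)_(g+f) / (x;q)_g`. -/
theorem isBigO_inv_qPoch_mul_pow {x q : ℂ} (hq : ‖q‖ < 1) {f : α → ℕ}
    (h : (∀ s, f s = 0) ∨ ∀ n : ℕ, x * q ^ n ≠ 1) (g : α → ℕ) :
    (fun s => (qPoch (x * q ^ g s) q (f s))⁻¹) =O[l] (fun _ => (1 : ℝ)) := by
  rcases h with h | h
  · simpa [h, qPoch_zero] using isBigO_refl (fun _ : α => (1 : ℝ)) l
  · have hsplit : ∀ s, (qPoch (x * q ^ g s) q (f s))⁻¹ =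
        qPoch x q (g s) * (qPoch x q (g s + f s))⁻¹ := fun s => by
      have hne := qPoch_ne_zero h (g s)
      have : qPoch x q (g s + f s) = qPoch x q (g s) * qPoch (x * q ^ g s) q (f s) := by
        simp only [qPoch, Finset.prod_range_add, pow_add, mul_assoc]
      rw [this, mul_inv, mul_inv_cancel_left₀ hne]
    simp only [hsplit]
    simpa using (isBigO_qPoch x hq g).mul (isBigO_inv_qPoch (l := l) hq h fun s => g s + f s)

theorem isBigO_inv_one_sub {x q : ℂ} (hq : ‖q‖ < 1) (h : ∀ n : ℕ, x * q ^ n ≠ 1) (g : α → ℕ) :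
    (fun s => (1 - x * q ^ g s)⁻¹) =O[l] (fun _ => (1 : ℝ)) := by
  simpa [qPoch] using isBigO_inv_qPoch_mul_pow (l := l) (f := fun _ => 1) hq (.inr h) g

theorem isBigO_truncFactor {q a x : ℂ} (hq : ‖q‖ < 1) (hax : ∀ n : ℕ, q * a / x * q ^ n ≠ 1)
    {f : α → ℕ} (h : (∀ s, f s = 0) ∨ ∀ n : ℕ, x * q ^ n ≠ 1) (g : α → ℕ) :
    (fun s => truncFactor q a x (g s) (f s)) =O[l] (fun _ => (1 : ℝ)) := by
  have := (isBigO_qPoch (l := l) (q * a / x) hq fun s => g s - f s).mul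
    ((isBigO_inv_qPoch_mul_pow (l := l) hq h g).mul (isBigO_inv_qPoch (l := l) hq hax g))
  simpa [truncFactor, div_eq_mul_inv, mul_comm, mul_left_comm] using this

theorem tendsto_qPoch_sub_div {q x : ℂ} (hq : ‖q‖ < 1) (h : ∀ n : ℕ, x * q ^ n ≠ 1) (i : ℕ) :
    Tendsto (fun N => qPoch x q (N - i) / qPoch x q N) atTop (𝓝 1) := by
  have hne := qPochInf_ne_zero hq h
  have := ((tendsto_qPoch x hq).comp (tendsto_sub_atTop_nat i)).div (tendsto_qPoch x hq) hne
  simpa [hne, Function.comp_def, Pi.div_def] using this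

theorem tendsto_truncFactor {q a x : ℂ} (hq : ‖q‖ < 1) (hax : ∀ n : ℕ, q * a / x * q ^ n ≠ 1)
    (i : ℕ) : Tendsto (fun N => truncFactor q a x N i) atTop (𝓝 1) := by
  have := (tendsto_qPoch_sub_div hq hax i).mul ((tendsto_qPoch_mul_pow x hq i).inv₀ one_ne_zero)
  refine (this.congr fun N => ?_).trans (by simp)
  rw [truncFactor]
  field_simp

theorem continuous_stepProd (q a b c d e : ℂ) (i j k l : ℕ → ℕ) (m : ℕ) :
    Continuous (stepProd q a b c d e i j k l m) := by
  unfold stepProd stepFactor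
  fun_prop

/-! ### Uniform bounds along the path and the limit `N → ∞`. -/

namespace Admissible

variable {q a b c d e : ℂ} {i j k l : ℕ → ℕ}

theorem isBigO_latticeH (h : Admissible q a b c d e i j k l) (hq : ‖q‖ < 1) (F : Filter α)
    (g : α → ℕ) :
    (fun s => latticeH q a b c d e (i (g s)) (j (g s)) (k (g s)) (l (g s))) =O[F]
      (fun _ => (1 : ℝ)) := by
  have hP : ∀ (x : ℂ) (f : α → ℕ), (fun s => qPoch x q (f s)) =O[F] (fun _ => (1 : ℝ)) :=
    fun x f => isBigO_qPoch x hq f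
  have hI : ∀ {x : ℂ} (_ : ∀ n : ℕ, x * q ^ n ≠ 1) (f : α → ℕ),
    (fun s => (qPoch x q (f s))⁻¹) =O[F] (fun _ => (1 : ℝ)) := fun hx f => isBigO_inv_qPoch hq hx f
  have hM : ∀ {u v : α → ℂ}, u =O[F] (fun _ => (1 : ℝ)) → v =O[F] (fun _ => (1 : ℝ)) →
      (fun s => u s * v s) =O[F] (fun _ => (1 : ℝ)) := fun hu hv => by simpa using hu.mul hv
  have hD : ∀ {u v : α → ℂ}, u =O[F] (fun _ => (1 : ℝ)) →
      (fun s => (v s)⁻¹) =O[F] (fun _ => (1 : ℝ)) →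
      (fun s => u s / v s) =O[F] (fun _ => (1 : ℝ)) := fun hu hv => by
    simpa [div_eq_mul_inv] using hu.mul hv
  unfold latticeH
  refine hD (hM (hM (hM (hM (hP _ _) (hP _ _)) (hP _ _)) (hP _ _))
    (hM (hM (hM (hM (hM (hP _ _) (hP _ _)) (hP _ _)) (hP _ _)) (hP _ _)) (hP _ _))) ?_
  simp only [mul_inv]
  exact hM (hI h.hqq _) (hM (hM (hM (hI h.hab _) (hI h.hac _)) (hI h.had _)) (hI h.hae _))

/-- Everything except `Θ` is bounded. With `F = ⊤` on `ℕ × ℕ` this becomes one constant for all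
pairs `(N, m)`, as domination requires. -/
theorem isBigO_truncTerm (h : Admissible q a b c d e i j k l) (hq : ‖q‖ < 1) (F : Filter α)
    (N g : α → ℕ) :
    (fun s => truncTerm q a b c d e (N s) (i (g s)) (j (g s)) (k (g s)) (l (g s))) =O[F]
      (fun s => latticeTheta q a b c d e (i (g s)) (j (g s)) (k (g s)) (l (g s))) := by
  have h1 := (isBigO_qPoch (l := F) q hq N).mul (isBigO_inv_qPoch (l := F) hq h.hqq
    fun s => N s - (i (g s) + j (g s) + k (g s) + l (g s)))
  have h2 := isBigO_qPoch_mul_pow (l := F) a hq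
    (fun s => i (g s) + j (g s) + k (g s) + l (g s)) N
  have h3 := (((isBigO_truncFactor (l := F) (f := fun s => i (g s)) hq h.hab
      (h.hbi.imp_left fun h s => h _) N).mul
    (isBigO_truncFactor (l := F) (f := fun s => j (g s)) hq h.hac
      (h.hcj.imp_left fun h s => h _) N)).mul
    (isBigO_truncFactor (l := F) (f := fun s => k (g s)) hq h.had
      (h.hdk.imp_left fun h s => h _) N)).mul
    (isBigO_truncFactor (l := F) (f := fun s => l (g s)) hq h.hae
      (h.hel.imp_left fun h s => h _) N)
  have h4 := (((isBigO_refl (fun s => latticeTheta q a b c d e (i (g s)) (j (g s)) (k (g s))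
    (l (g s))) F).norm_right.mul (h.isBigO_latticeH hq F g)).mul h1).mul h2 |>.mul h3
  simp only [mul_one, ← div_eq_mul_inv] at h4
  exact h4.of_norm_right

theorem tendsto_truncTerm (h : Admissible q a b c d e i j k l) (hq : ‖q‖ < 1) (m : ℕ) :
    Tendsto (fun N => truncTerm q a b c d e N (i m) (j m) (k m) (l m)) atTop
      (𝓝 (weight q a b c d e (i m) (j m) (k m) (l m))) := by
  have h1 := (tendsto_qPoch_sub_div hq h.hqq (i m + j m + k m + l m)).inv₀ one_ne_zero
  simp only [inv_div] at h1
  have := ((h1.const_mul (weight q a b c d e (i m) (j m) (k m) (l m))).mul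
    (tendsto_qPoch_mul_pow a hq (i m + j m + k m + l m))).mul
    ((((tendsto_truncFactor hq h.hab (i m)).mul (tendsto_truncFactor hq h.hac (j m))).mul
      (tendsto_truncFactor hq h.had (k m))).mul (tendsto_truncFactor hq h.hae (l m)))
  simpa only [truncTerm, inv_one, mul_one] using this

theorem tendsto_stepProd (hq : ‖q‖ < 1) (m : ℕ) :
    Tendsto (fun N => stepProd q a b c d e i j k l m (q ^ N)) atTop (𝓝 1) := by
  have := ((continuous_stepProd q a b c d e i j k l m).tendsto 0).comp
    (tendsto_pow_atTop_nhds_zero_of_norm_lt_one hq)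
  simpa [stepProd, stepFactor, Function.comp_def] using this

theorem le_self (h : Admissible q a b c d e i j k l) (m : ℕ) : i m ≤ m := by
  have := h.sum_eq m
  omega

theorem exists_bound_of_step (h : Admissible q a b c d e i j k l) (hq : ‖q‖ < 1) :
    ∃ C : ℝ, ∀ m N, m < N → i (m + 1) = i m + 1 →
      ‖stepProd q a b c d e i j k l m (q ^ m) / stepProd q a b c d e i j k l m (q ^ N)‖ ≤ C := by
  by_cases hb : ∀ n : ℕ, b * q ^ n ≠ 1
  swap
  -- If some `b q^n = 1`, the path never moves in the direction of `b` and any constant will do.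
  · exact ⟨0, fun m N _ hm => absurd (h.not_zero_of_step hm) hb⟩
  have hP : ∀ (x : ℂ) (f : ℕ × ℕ → ℕ), (fun s => 1 - x * q ^ f s) =O[⊤] (fun _ => (1 : ℝ)) :=
    fun x f => by simpa [qPoch] using isBigO_qPoch_mul_pow (l := ⊤) x hq (fun _ : ℕ × ℕ => 1) f
  have hb := (((hP b fun s => i s.1 + s.1).mul (hP (a / b) fun s => s.1 - i s.1)).mul
    (isBigO_inv_one_sub (l := ⊤) hq hb fun s : ℕ × ℕ => i s.1 + s.2)).mul
    (isBigO_inv_one_sub (l := ⊤) hq h.hab fun s : ℕ × ℕ => s.2 - (i s.1 + 1))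
  obtain ⟨C, hC⟩ := isBigO_top.1 hb
  refine ⟨C, fun m N hmN hm => ?_⟩
  have h1 : a * q ^ m / (b * q ^ i m) = a / b * q ^ (m - i m) := by
    rw [pow_sub₀ _ h.hq (h.le_self m)]
    ring
  -- One `q` is split off because nonvanishing is known for `qa/b`, not `a/b`; `m < N` gives `i m +
  -- 1 ≤ N`.
  have h2 : a * q ^ N / (b * q ^ i m) = q * a / b * q ^ (N - (i m + 1)) := by
    have := h.hq
    rw [pow_sub₀ _ h.hq (by have := h.le_self m; omega), pow_succ]
    field_simp
  rw [h.stepProd_eq hm, stepFactor, stepFactor, h1, h2, mul_assoc b, mul_assoc b, ← pow_add,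
    ← pow_add, div_eq_mul_inv, mul_inv, ← mul_assoc]
  simpa using hC (m, N)

theorem exists_bound_stepProd (h : Admissible q a b c d e i j k l) (hq : ‖q‖ < 1) :
    ∃ C : ℝ, ∀ m N, m < N →
      ‖stepProd q a b c d e i j k l m (q ^ m) / stepProd q a b c d e i j k l m (q ^ N)‖ ≤ C := by
  obtain ⟨C₁, h₁⟩ := h.exists_bound_of_step hq
  obtain ⟨C₂, h₂⟩ := h.swap_bc.exists_bound_of_step hq
  obtain ⟨C₃, h₃⟩ := h.swap_bd.exists_bound_of_step hq
  obtain ⟨C₄, h₄⟩ := h.swap_be.exists_bound_of_step hq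
  rw [stepProd_swap_bc] at h₂
  rw [stepProd_swap_bd] at h₃
  rw [stepProd_swap_be] at h₄
  refine ⟨max (max C₁ C₂) (max C₃ C₄), fun m N hmN => ?_⟩
  rcases h.step_cases m with hm | hm | hm | hm
  · exact (h₁ m N hmN hm).trans ((le_max_left _ _).trans (le_max_left _ _))
  · exact (h₂ m N hmN hm).trans ((le_max_right _ _).trans (le_max_left _ _))
  · exact (h₃ m N hmN hm).trans ((le_max_left _ _).trans (le_max_right _ _))
  · exact (h₄ m N hmN hm).trans ((le_max_right _ _).trans (le_max_right _ _))

theorem tendsto_prodTrunc (h : Admissible q a b c d e i j k l) (hq : ‖q‖ < 1) :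
    Tendsto (prodTrunc q a b c d e) atTop
      (𝓝 (qPochInf b q / qPochInf (q * a / b) q * (qPochInf c q / qPochInf (q * a / c) q) *
        (qPochInf d q / qPochInf (q * a / d) q) * (qPochInf e q / qPochInf (q * a / e) q))) := by
  have hT : ∀ x : ℂ, (∀ n : ℕ, q * a / x * q ^ n ≠ 1) → Tendsto
      (fun N => qPoch x q N / qPoch (q * a / x) q N) atTop
      (𝓝 (qPochInf x q / qPochInf (q * a / x) q)) := fun x hx =>
    (tendsto_qPoch x hq).div (tendsto_qPoch _ hq) (qPochInf_ne_zero hq hx)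
  exact (((hT b h.hab).mul (hT c h.hac)).mul (hT d h.had)).mul (hT e h.hae)

/-- The series along an admissible lattice path, if `Θ` is summable along the path. -/
theorem summable_and_tsum_eq (h : Admissible q a b c d e i j k l) (hq : ‖q‖ < 1)
    (hΘ : Summable fun m => ‖latticeTheta q a b c d e (i m) (j m) (k m) (l m)‖) :
    (Summable fun m => weight q a b c d e (i m) (j m) (k m) (l m) *
      stepProd q a b c d e i j k l m (q ^ m)) ∧
    ∑' m, weight q a b c d e (i m) (j m) (k m) (l m) * stepProd q a b c d e i j k l m (q ^ m) =
      qPochInf b q / qPochInf (q * a / b) q * (qPochInf c q / qPochInf (q * a / c) q) *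
        (qPochInf d q / qPochInf (q * a / d) q) * (qPochInf e q / qPochInf (q * a / e) q) := by
  obtain ⟨C₁, hC₁⟩ := isBigO_top.1 (h.isBigO_truncTerm hq ⊤ (Prod.fst : ℕ × ℕ → ℕ) Prod.snd)
  obtain ⟨C₂, hC₂⟩ := h.exists_bound_stepProd hq
  set θ : ℕ → ℝ := fun m => ‖latticeTheta q a b c d e (i m) (j m) (k m) (l m)‖ with hθ
  set T : ℕ → ℕ → ℂ := fun N m => truncTerm q a b c d e N (i m) (j m) (k m) (l m) *
    (stepProd q a b c d e i j k l m (q ^ m) / stepProd q a b c d e i j k l m (q ^ N)) with hT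
  set t : ℕ → ℂ := fun m => weight q a b c d e (i m) (j m) (k m) (l m) *
      stepProd q a b c d e i j k l m (q ^ m) with ht
  have hbound : ∀ N m, m < N → ‖T N m‖ ≤ C₁ * θ m * C₂ := fun N m hmN => by
    rw [hT, norm_mul]
    exact mul_le_mul (hC₁ (N, m)) (hC₂ m N hmN) (norm_nonneg _)
      ((norm_nonneg _).trans (hC₁ (N, m)))
  have hlim : ∀ m, Tendsto (fun N => T N m) atTop (𝓝 (t m)) := fun m => by
    have := (h.tendsto_truncTerm hq m).mul
      ((tendsto_stepProd (a := a) (b := b) (c := c) (d := d) (e := e) (i := i) (j := j) (k := k)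
        (l := l) hq m).inv₀ one_ne_zero |>.const_mul (stepProd q a b c d e i j k l m (q ^ m)))
    simpa only [inv_one, mul_one, ← div_eq_mul_inv] using this
  have hsum : Summable fun m => C₁ * θ m * C₂ := (hΘ.mul_left C₁).mul_right C₂
  have htb : ∀ m, ‖t m‖ ≤ C₁ * θ m * C₂ := fun m =>
    le_of_tendsto (hlim m).norm ((eventually_gt_atTop m).mono fun N hN => hbound N m hN)
  have hts : Summable t := .of_norm_bounded hsum htb
  refine ⟨hts, ?_⟩
  -- The finite sums are extended by zero so that dominated convergence for series applies.
  have hdom : Tendsto (fun N => ∑' m, if m < N then T N m else 0) atTop (𝓝 (∑' m, t m)) := by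
    refine tendsto_tsum_of_dominated_convergence hsum (fun m => ?_) (.of_forall fun N m => ?_)
    · refine (hlim m).congr' ((eventually_gt_atTop m).mono fun N hN => ?_)
      exact (if_pos hN).symm
    · split_ifs with hmN
      · exact hbound N m hmN
      · rw [norm_zero]
        exact (norm_nonneg _).trans (htb m)
  have hfin : ∀ N, (∑' m, if m < N then T N m else 0) = ∑ m ∈ Finset.range N, T N m := fun N => by
    rw [tsum_eq_sum (s := Finset.range N) fun m hm => if_neg (by simpa using hm)]
    exact Finset.sum_congr rfl fun m hm => if_pos (Finset.mem_range.1 hm)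
  -- The uniform bound on the diagonal `m = N` is a multiple of `|Θ(N)|`, the general term of a
  -- convergent series.
  have hlast : Tendsto (fun N => truncTerm q a b c d e N (i N) (j N) (k N) (l N)) atTop (𝓝 0) := by
    refine squeeze_zero_norm (fun N => hC₁ (N, N)) ?_
    simpa using hΘ.tendsto_atTop_zero.const_mul C₁
  simp only [hfin] at hdom
  refine tendsto_nhds_unique ?_ (h.tendsto_prodTrunc hq)
  have := hdom.add hlast
  rw [add_zero] at this
  exact this.congr h.sum_truncTerm

/-- `Θ` is summable along the path if the ratios for all four directions are eventually at most
some `r < 1`. -/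
theorem summable_latticeTheta (h : Admissible q a b c d e i j k l) {r : ℝ} (hr : r < 1)
    (hb : ∀ᶠ m in atTop, ‖a * q ^ m / (b * q ^ i m)‖ ≤ r)
    (hc : ∀ᶠ m in atTop, ‖a * q ^ m / (c * q ^ j m)‖ ≤ r)
    (hd : ∀ᶠ m in atTop, ‖a * q ^ m / (d * q ^ k m)‖ ≤ r)
    (he : ∀ᶠ m in atTop, ‖a * q ^ m / (e * q ^ l m)‖ ≤ r) :
    Summable fun m => ‖latticeTheta q a b c d e (i m) (j m) (k m) (l m)‖ := by
  refine summable_of_ratio_norm_eventually_le hr ?_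
  have key : ∀ {b c d e : ℂ} {i j k l : ℕ → ℕ}, Admissible q a b c d e i j k l → ∀ {m : ℕ},
      i (m + 1) = i m + 1 → ‖a * q ^ m / (b * q ^ i m)‖ ≤ r →
      ‖latticeTheta q a b c d e (i (m + 1)) (j (m + 1)) (k (m + 1)) (l (m + 1))‖ ≤
        r * ‖latticeTheta q a b c d e (i m) (j m) (k m) (l m)‖ := by
    intro b c d e i j k l h m hm hle
    obtain ⟨h1, h2, h3⟩ := h.eq_of_step hm
    rw [hm, h1, h2, h3, latticeTheta_succ c d e h.hq, h.sum_eq, norm_mul, mul_comm]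
    exact mul_le_mul_of_nonneg_right hle (norm_nonneg _)
  filter_upwards [hb, hc, hd, he] with m h1 h2 h3 h4
  simp only [norm_norm]
  rcases h.step_cases m with hm | hm | hm | hm
  · exact key h hm h1
  · simpa only [latticeTheta_swap_bc] using key h.swap_bc hm h2
  · simpa only [latticeTheta_swap_bd] using key h.swap_bd hm h3
  · simpa only [latticeTheta_swap_be] using key h.swap_be hm h4

end Admissible

end JacksonDual

/-! ### From lattice paths back to `φ`, `H`, `Θ` and the floor functions. -/

namespace JacksonDual

open Filter Topology

/-- The symmetric form of `φ`, on the lattice `ℕ⁴`. -/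
def latticePhi (q a b c d e x : ℂ) (i j k l : ℕ) : ℂ :=
  qPoch (b * x) q i * qPoch (c * x) q j * qPoch (d * x) q k * qPoch (e * x) q l *
    (qPoch (b / (a * x)) q i * qPoch (c / (a * x)) q j * qPoch (d / (a * x)) q k *
      qPoch (e / (a * x)) q l)

theorem latticePhi_swap_bc (q a b c d e x : ℂ) (i j k l : ℕ) :
    latticePhi q a c b d e x j i k l = latticePhi q a b c d e x i j k l := by
  rw [latticePhi, latticePhi]
  ring

theorem latticePhi_swap_bd (q a b c d e x : ℂ) (i j k l : ℕ) :
    latticePhi q a d c b e x k j i l = latticePhi q a b c d e x i j k l := by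
  rw [latticePhi, latticePhi]
  ring

theorem latticePhi_swap_be (q a b c d e x : ℂ) (i j k l : ℕ) :
    latticePhi q a e c d b x l j k i = latticePhi q a b c d e x i j k l := by
  rw [latticePhi, latticePhi]
  ring

theorem latticePhi_succ (q a b c d e x : ℂ) (i j k l : ℕ) :
    latticePhi q a b c d e x (i + 1) j k l =
      latticePhi q a b c d e x i j k l *
        ((1 - b * x * q ^ i) * (1 - b / (a * x) * q ^ i)) := by
  rw [latticePhi, latticePhi, qPoch_succ, qPoch_succ]
  ring

namespace Admissible

variable {q a b c d e : ℂ} {i j k l : ℕ → ℕ}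

/-- The ratio `a q^m / (b q^i)` of `Θ`, together with the minus sign, turns the factor `1 - b q^i /
(a q^m)` of `φ` into `1 - a q^m / (b q^i)`. -/
theorem theta_mul_phi_div_of_step (h : Admissible q a b c d e i j k l) {m : ℕ}
    (hφ : latticePhi q a b c d e (q ^ m) (i m) (j m) (k m) (l m) ≠ 0)
    (hm : i (m + 1) = i m + 1) :
    latticeTheta q a b c d e (i (m + 1)) (j (m + 1)) (k (m + 1)) (l (m + 1)) *
      (latticePhi q a b c d e (q ^ m) (i (m + 1)) (j (m + 1)) (k (m + 1)) (l (m + 1)) /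
        (-latticePhi q a b c d e (q ^ m) (i m) (j m) (k m) (l m))) =
      latticeTheta q a b c d e (i m) (j m) (k m) (l m) *
        stepProd q a b c d e i j k l m (q ^ m) := by
  obtain ⟨h1, h2, h3⟩ := h.eq_of_step hm
  have hq := h.hq
  have ha := h.ha
  have hb := h.hb
  rw [h.stepProd_eq hm, hm, h1, h2, h3, latticePhi_succ, latticeTheta_succ c d e hq, h.sum_eq,
    stepFactor, div_neg, mul_div_cancel_left₀ _ hφ]
  field_simp
  ring

theorem theta_mul_phi_div (h : Admissible q a b c d e i j k l) {m : ℕ}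
    (hφ : latticePhi q a b c d e (q ^ m) (i m) (j m) (k m) (l m) ≠ 0) :
    latticeTheta q a b c d e (i (m + 1)) (j (m + 1)) (k (m + 1)) (l (m + 1)) *
      (latticePhi q a b c d e (q ^ m) (i (m + 1)) (j (m + 1)) (k (m + 1)) (l (m + 1)) /
        (-latticePhi q a b c d e (q ^ m) (i m) (j m) (k m) (l m))) =
      latticeTheta q a b c d e (i m) (j m) (k m) (l m) *
        stepProd q a b c d e i j k l m (q ^ m) := by
  rcases h.step_cases m with hm | hm | hm | hm
  · exact h.theta_mul_phi_div_of_step hφ hm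
  · rw [← latticePhi_swap_bc] at hφ
    simpa only [latticeTheta_swap_bc, latticePhi_swap_bc, stepProd_swap_bc] using
      h.swap_bc.theta_mul_phi_div_of_step hφ hm
  · rw [← latticePhi_swap_bd] at hφ
    simpa only [latticeTheta_swap_bd, latticePhi_swap_bd, stepProd_swap_bd] using
      h.swap_bd.theta_mul_phi_div_of_step hφ hm
  · rw [← latticePhi_swap_be] at hφ
    simpa only [latticeTheta_swap_be, latticePhi_swap_be, stepProd_swap_be] using
      h.swap_be.theta_mul_phi_div_of_step hφ hm

end Admissible

/-! ### Floor paths -/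

theorem monotone_floor (ε lam L : ℕ) : Monotone fun n : ℕ => (ε + n * lam) / L :=
  fun m n h => Nat.div_le_div_right (by gcongr)

/-- If `lam = 0` the floor is constant. Otherwise the floor at `(n + 1) L` is at least `n + 1`, so
the nonvanishing product contains the factor `1 - x q^n`. -/
theorem floor_eq_zero_or_ne_one {ε lam L : ℕ} {x q : ℂ} (hL : 0 < L) (h0 : (ε + 0 * lam) / L = 0)
    (h : ∀ n : ℕ, 1 ≤ n → qPoch x q ((ε + n * L * lam) / L) ≠ 0) :
    (∀ n : ℕ, (ε + n * lam) / L = 0) ∨ ∀ n : ℕ, x * q ^ n ≠ 1 := by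
  rcases Nat.eq_zero_or_pos lam with rfl | hlam
  · exact .inl fun n => by simpa using h0
  · refine .inr fun n hn => h (n + 1) (by omega) ?_
    refine Finset.prod_eq_zero (i := n) (Finset.mem_range.2 ?_) (by rw [hn, sub_self])
    rw [Nat.lt_iff_add_one_le, Nat.le_div_iff_mul_le hL]
    calc (n + 1) * L ≤ (n + 1) * L * lam := Nat.le_mul_of_pos_right _ hlam
      _ ≤ _ := Nat.le_add_left _ _

/-- The expression is `(a/x) q^(m - ⟨m⟩)`. If `lam < L`, the exponent tends to infinity and the
ratio to zero; only for `lam = L` is a condition on `a/x` needed. -/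
theorem exists_floor_ratio_le {ε lam L : ℕ} {a x q : ℂ} (hq0 : q ≠ 0) (hq : ‖q‖ < 1) (hL : 0 < L)
    (hlam : lam ≤ L) (hle : ∀ n : ℕ, (ε + n * lam) / L ≤ n) (h : lam = L → ‖a / x‖ < 1) :
    ∃ r < 1, ∀ᶠ m : ℕ in atTop, ‖a * q ^ m / (x * q ^ ((ε + m * lam) / L))‖ ≤ r := by
  have hrw : ∀ m : ℕ, a * q ^ m / (x * q ^ ((ε + m * lam) / L)) =
      a / x * q ^ (m - (ε + m * lam) / L) := fun m => by
    rw [pow_sub₀ _ hq0 (hle m)]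
    ring
  simp only [hrw]
  rcases hlam.eq_or_lt with h1 | h1
  · refine ⟨‖a / x‖, h h1, .of_forall fun m => ?_⟩
    rw [norm_mul, norm_pow]
    exact mul_le_of_le_one_right (norm_nonneg _) (pow_le_one₀ (norm_nonneg q) hq.le)
  · have hexp : Tendsto (fun m : ℕ => m - (ε + m * lam) / L) atTop atTop := by
      -- For such `m`, `ε + m lam + K L ≤ m (lam + 1) ≤ m L`.
      refine tendsto_atTop.2 fun K => (eventually_ge_atTop (K * L + ε)).mono fun m hm => ?_
      have h2 : (ε + m * lam) / L + K ≤ m := by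
        rw [← Nat.add_mul_div_right _ _ hL]
        refine Nat.div_le_of_le_mul ?_
        have : m * (lam + 1) ≤ m * L := Nat.mul_le_mul_left m h1
        linarith
      omega
    have hlim : Tendsto (fun m : ℕ => ‖a / x * q ^ (m - (ε + m * lam) / L)‖) atTop (𝓝 0) := by
      simpa using (((tendsto_pow_atTop_nhds_zero_of_norm_lt_one hq).comp hexp).const_mul
        (a / x)).norm
    exact ⟨1 / 2, by norm_num, (hlim.eventually (gt_mem_nhds (by norm_num))).mono fun m => le_of_lt⟩

/-! ### The four-parameter quantities in symmetric form -/

section Symmetric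

variable (P : Pattern) {a b c d q : ℂ}

theorem H_eq_latticeH (hP : P.IsPartition) (hq : q ≠ 0) (ha : a ≠ 0) (hb : b ≠ 0) (hc : c ≠ 0)
    (hd : d ≠ 0) (n : ℕ) :
    H P a b c d q n =
      latticeH q a b c d (q * a ^ 2 / (b * c * d)) (P.pb n) (P.pc n) (P.pd n) (P.pe n) := by
  have h1 : b * (q * a ^ 2 / (b * c * d)) / a = q * a / (c * d) := by field_simp
  have h2 : c * (q * a ^ 2 / (b * c * d)) / a = q * a / (b * d) := by field_simp
  have h3 : d * (q * a ^ 2 / (b * c * d)) / a = q * a / (b * c) := by field_simp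
  have h4 : q * a / (q * a ^ 2 / (b * c * d)) = b * c * d / a := by field_simp
  rw [H, latticeH, ← hP n, h1, h2, h3, h4, div_mul_div_comm, div_mul_div_comm, div_mul_div_comm]
  congr 1 <;> ring

theorem Theta_eq_latticeTheta (hP : P.IsPartition) (hq : q ≠ 0) (ha : a ≠ 0) (hb : b ≠ 0)
    (hc : c ≠ 0) (hd : d ≠ 0) (n : ℕ) :
    Theta P a b c d q n =
      latticeTheta q a b c d (q * a ^ 2 / (b * c * d)) (P.pb n) (P.pc n) (P.pd n) (P.pe n) := by
  have h : a / (q * a ^ 2 / (b * c * d)) = b * c * d / (q * a) := by field_simp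
  rw [Theta, latticeTheta, ← hP n, h]

theorem phi_eq_latticePhi (ha : a ≠ 0) (x : ℂ) (n : ℕ) :
    phi P a b c d q x n =
      latticePhi q a b c d (q * a ^ 2 / (b * c * d)) x (P.pb n) (P.pc n) (P.pd n) (P.pe n) := by
  have h1 : q * a ^ 2 * x / (b * c * d) = q * a ^ 2 / (b * c * d) * x := by ring
  have h2 : q * a / (b * c * d * x) = q * a ^ 2 / (b * c * d) / (a * x) := by
    field_simp
  rw [phi, latticePhi, h1, h2]

theorem Theta_ne_zero (hq : q ≠ 0) (ha : a ≠ 0) (hb : b ≠ 0) (hc : c ≠ 0) (hd : d ≠ 0) (n : ℕ) :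
    Theta P a b c d q n ≠ 0 := by
  unfold Theta
  positivity

end Symmetric

/-! ### Grouping into blocks -/

/-- Division with remainder identifies `ℕ` with `ℕ × Fin L`, and the sum is taken fibrewise. -/
theorem hasSum_blocks {f : ℕ → ℂ} (hf : Summable f) {L : ℕ} (hL : 0 < L) :
    HasSum (fun n => ∑ r ∈ Finset.range L, f (n * L + r)) (∑' m, f m) := by
  have : NeZero L := ⟨hL.ne'⟩
  have h := (Nat.divModEquiv L).symm.hasSum_iff.2 hf.hasSum
  have := h.prod_fiberwise fun n => hasSum_fintype _
  refine this.congr_fun fun n => ?_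
  rw [Finset.sum_range]
  simp

/-- With `j = δ - Λ + r` the index `j + (n+1)Λ` is `nΛ + r + δ`, and the normalising factors `H` and
`Θ` at `(n+1)Λ` cancel. -/
theorem blockTerm_eq_sum (P : Pattern) {a b c d q : ℂ} {δ n : ℕ}
    (hH : H P a b c d q ((n + 1) * P.Lam) ≠ 0) (hΘ : Theta P a b c d q ((n + 1) * P.Lam) ≠ 0) :
    blockTerm P a b c d q δ (n + 1) =
      ∑ r ∈ Finset.range P.Lam, Theta P a b c d q (n * P.Lam + r + δ + 1) *
        (phi P a b c d q (q ^ (n * P.Lam + r + δ)) (n * P.Lam + r + δ + 1) /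
          (-phi P a b c d q (q ^ (n * P.Lam + r + δ)) (n * P.Lam + r + δ))) *
        H P a b c d q (n * P.Lam + r + δ) := by
  rw [blockTerm, Finset.mul_sum]
  refine Finset.sum_nbij' (fun j => (j - ((δ : ℤ) - P.Lam)).toNat) (fun r => (δ : ℤ) - P.Lam + r)
    (fun j hj => ?_) (fun r hr => ?_) (fun j hj => ?_) (fun r hr => ?_) (fun j hj => ?_)
  · simp only [Finset.mem_Ico, Finset.mem_range] at *
    omega
  · simp only [Finset.mem_Ico, Finset.mem_range] at *
    omega
  · simp only [Finset.mem_Ico] at *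
    omega
  · simp
  · obtain ⟨r, rfl⟩ : ∃ r : ℕ, j = (δ : ℤ) - P.Lam + r :=
      ⟨(j - ((δ : ℤ) - P.Lam)).toNat, by simp only [Finset.mem_Ico] at hj; omega⟩
    have hm : ((δ : ℤ) - P.Lam + r + ((n + 1 : ℕ) : ℤ) * P.Lam).toNat = n * P.Lam + r + δ := by
      rw [show (δ : ℤ) - P.Lam + r + ((n + 1 : ℕ) : ℤ) * P.Lam = ((n * P.Lam + r + δ : ℕ) : ℤ) by
        push_cast; ring, Int.toNat_natCast]
    rw [show ((δ : ℤ) - P.Lam + r - ((δ : ℤ) - P.Lam)).toNat = r by simp]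
    simp only [hm, add_comm 1 (n * P.Lam + r + δ)]
    field_simp

end JacksonDual

end

/-! ### The identity for floor patterns. -/

theorem theorem2p2
    (P : JacksonDual.Pattern) (hP : P.IsPartition)
    (δ : ℕ) (hδ : δ < P.Lam)
    (a b c d q : ℂ)
    (hq0 : q ≠ 0) (hq1 : ‖q‖ < 1)
    (ha : a ≠ 0) (hb : b ≠ 0) (hc : c ≠ 0) (hd : d ≠ 0)
    -- the denominators in the identity do not vanish
    (hab : ∀ n : ℕ, q * a / b * q ^ n ≠ 1)
    (hac : ∀ n : ℕ, q * a / c * q ^ n ≠ 1)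
    (had : ∀ n : ℕ, q * a / d * q ^ n ≠ 1)
    (hbcd : ∀ n : ℕ, b * c * d / a * q ^ n ≠ 1)
    (hphi : ∀ k : ℕ, JacksonDual.phi P a b c d q (q ^ k) k ≠ 0)
    (hH : ∀ n : ℕ, 1 ≤ n → JacksonDual.H P a b c d q (n * P.Lam) ≠ 0)
    -- convergence in the degenerate patterns where a single `λ` is nonzero;
    -- for all other patterns these four hypotheses are vacuous
    (hcb : P.lamb = P.Lam → ‖a / b‖ < 1)
    (hcc : P.lamc = P.Lam → ‖a / c‖ < 1)
    (hcd : P.lamd = P.Lam → ‖a / d‖ < 1)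
    (hce : P.lame = P.Lam → ‖b * c * d / (q * a)‖ < 1) :
    Summable (fun n : ℕ => JacksonDual.blockTerm P a b c d q δ (n + 1)) ∧
    JacksonDual.productSide a b c d q =
      (∑ k ∈ Finset.range δ,
        JacksonDual.Theta P a b c d q (k + 1) *
          (JacksonDual.phi P a b c d q (q ^ k) (k + 1) /
            (-JacksonDual.phi P a b c d q (q ^ k) k)) *
          JacksonDual.H P a b c d q k) +
      ∑' n : ℕ, JacksonDual.blockTerm P a b c d q δ (n + 1) := by
  have hL : 0 < P.Lam := by omega
  set e : ℂ := q * a ^ 2 / (b * c * d) with he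
  have hzero : P.pb 0 = 0 ∧ P.pc 0 = 0 ∧ P.pd 0 = 0 ∧ P.pe 0 = 0 := by
    have := hP 0
    omega
  -- Nonvanishing of `H(nΛ)` does more than permit division by it: through its numerator it ensures
  -- `x q^n ≠ 1` for every parameter whose coordinate moves, which the truncated series needs.
  have hHL : ∀ n : ℕ, 1 ≤ n → JacksonDual.qPoch b q (P.pb (n * P.Lam)) ≠ 0 ∧
      JacksonDual.qPoch c q (P.pc (n * P.Lam)) ≠ 0 ∧
      JacksonDual.qPoch d q (P.pd (n * P.Lam)) ≠ 0 ∧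
      JacksonDual.qPoch e q (P.pe (n * P.Lam)) ≠ 0 := fun n hn => by
    have := hH n hn
    rw [JacksonDual.H] at this
    refine ⟨?_, ?_, ?_, ?_⟩ <;> intro h0 <;> exact this (by simp [h0, ← he])
  have hea : q * a / e = b * c * d / a := by
    rw [he]
    field_simp
  have hae : a / e = b * c * d / (q * a) := by
    rw [he]
    field_simp
  have hadm : JacksonDual.Admissible q a b c d e P.pb P.pc P.pd P.pe :=
    { hq := hq0
      ha := ha
      hb := hb
      hc := hc
      hd := hd
      he := by rw [he]; positivity
      rel := by rw [he]; field_simp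
      hqq := fun n h => by
        have h1 : ‖q ^ (n + 1)‖ < 1 := by
          rw [norm_pow]
          exact pow_lt_one₀ (norm_nonneg q) hq1 n.succ_ne_zero
        rw [pow_succ', h, norm_one] at h1
        exact lt_irrefl _ h1
      hab := hab
      hac := hac
      had := had
      hae := by rwa [hea]
      hbi := JacksonDual.floor_eq_zero_or_ne_one hL hzero.1 fun n hn => (hHL n hn).1
      hcj := JacksonDual.floor_eq_zero_or_ne_one hL hzero.2.1 fun n hn => (hHL n hn).2.1
      hdk := JacksonDual.floor_eq_zero_or_ne_one hL hzero.2.2.1 fun n hn => (hHL n hn).2.2.1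
      hel := JacksonDual.floor_eq_zero_or_ne_one hL hzero.2.2.2 fun n hn => (hHL n hn).2.2.2
      sum_eq := fun m => (hP m).symm
      mono_i := JacksonDual.monotone_floor _ _ _
      mono_j := JacksonDual.monotone_floor _ _ _
      mono_k := JacksonDual.monotone_floor _ _ _
      mono_l := JacksonDual.monotone_floor _ _ _ }
  have hlam : P.lamb ≤ P.Lam ∧ P.lamc ≤ P.Lam ∧ P.lamd ≤ P.Lam ∧ P.lame ≤ P.Lam := by
    unfold JacksonDual.Pattern.Lam
    omega
  obtain ⟨r₁, hr₁, h₁⟩ := JacksonDual.exists_floor_ratio_le (ε := P.epsb) hq0 hq1 hL hlam.1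
    hadm.le_self hcb
  obtain ⟨r₂, hr₂, h₂⟩ := JacksonDual.exists_floor_ratio_le (ε := P.epsc) hq0 hq1 hL hlam.2.1
    hadm.swap_bc.le_self hcc
  obtain ⟨r₃, hr₃, h₃⟩ := JacksonDual.exists_floor_ratio_le (ε := P.epsd) hq0 hq1 hL hlam.2.2.1
    hadm.swap_bd.le_self hcd
  obtain ⟨r₄, hr₄, h₄⟩ := JacksonDual.exists_floor_ratio_le (ε := P.epse) hq0 hq1 hL hlam.2.2.2
    hadm.swap_be.le_self (fun h => by rw [hae]; exact hce h)
  have hΘ := hadm.summable_latticeTheta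
    (max_lt (max_lt hr₁ hr₂) (max_lt hr₃ hr₄))
    (h₁.mono fun m h => h.trans ((le_max_left _ _).trans (le_max_left _ _)))
    (h₂.mono fun m h => h.trans ((le_max_right _ _).trans (le_max_left _ _)))
    (h₃.mono fun m h => h.trans ((le_max_left _ _).trans (le_max_right _ _)))
    (h₄.mono fun m h => h.trans ((le_max_right _ _).trans (le_max_right _ _)))
  obtain ⟨hsum, htsum⟩ := hadm.summable_and_tsum_eq hq1 hΘ
  set t : ℕ → ℂ := fun k => JacksonDual.Theta P a b c d q (k + 1) *
    (JacksonDual.phi P a b c d q (q ^ k) (k + 1) / (-JacksonDual.phi P a b c d q (q ^ k) k)) *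
    JacksonDual.H P a b c d q k with ht
  have hterm : (fun m => JacksonDual.weight q a b c d e (P.pb m) (P.pc m) (P.pd m) (P.pe m) *
      JacksonDual.stepProd q a b c d e P.pb P.pc P.pd P.pe m (q ^ m)) = t := by
    ext m
    have hφ := hphi m
    rw [JacksonDual.phi_eq_latticePhi P ha] at hφ
    rw [ht]
    simp only [JacksonDual.phi_eq_latticePhi P ha,
      JacksonDual.Theta_eq_latticeTheta P hP hq0 ha hb hc hd,
      JacksonDual.H_eq_latticeH P hP hq0 ha hb hc hd]
    rw [hadm.theta_mul_phi_div hφ, JacksonDual.weight]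
    ring
  rw [hterm] at hsum
  have htsum' := congrArg tsum hterm
  rw [htsum] at htsum'
  -- The first `δ` terms are removed before grouping; they form the finite sum in the statement.
  have hblock := JacksonDual.hasSum_blocks ((summable_nat_add_iff δ).2 hsum) hL
  have hfun : (fun n : ℕ => JacksonDual.blockTerm P a b c d q δ (n + 1)) =
      fun n => ∑ r ∈ Finset.range P.Lam, t (n * P.Lam + r + δ) := funext fun n =>
    JacksonDual.blockTerm_eq_sum P (hH _ n.succ_pos)
      (JacksonDual.Theta_ne_zero P hq0 ha hb hc hd _)
  rw [hfun]
  refine ⟨hblock.summable, ?_⟩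
  rw [hblock.tsum_eq, hsum.sum_add_tsum_nat_add δ, ← htsum', JacksonDual.productSide, hea,
    div_mul_div_comm, div_mul_div_comm, div_mul_div_comm]
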